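/- **Setting.** Let $\mathcal S$ be a convenient category of topological spaces: a full subcategory of the category of topological spaces which contains all convex subsets of finite-dimensional real vector spaces and has finite products (for example compactly generated weak Hausdorff spaces), regarded as a cartesian monoidal category. Let $(\mathcal M,\square,\mathbf 1)$ be a closed symmetric monoidal category with countable colimits, and let $L\colon\mathcal S\to\mathcal M$ be a strong symmetric monoidal functor that is a left adjoint. A homotopy between maps $f,g\colon X\to Y$ in $\mathcal M$ is a map $X\,\square\,L[0,1]\to Y$ that restricts to $f$ and $g$ along the maps $X\cong X\,\square\,L(*)\to X\,\square\,L[0,1]$ given by the endpoints $0$ and $1$; a map $f\colon X\to Y$ is a homotopy equivalence in $\mathcal M$ if there is $g\colon Y\to X$ such that $g\circ f$ and $f\circ g$ are homotopic to the identities. Let $\overline{\mathcal C}_1$ be the non-symmetric operad of little $1$-cubes: $\overline{\mathcal C}_1(m)$ is the space of lists $[x_1,y_1],\dots,[x_m,y_m]$ of subintervals of $[0,1]$ with $x_i<y_i$ and $y_i\le x_{i+1}$, the unit is $[0,1]$, and the composition $\Gamma$ is composition of the corresponding affine embeddings $[0,1]\to[0,1]$. Let $\overline{\mathcal O}=L\overline{\mathcal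 C}_1$ be the resulting non-symmetric operad in $\mathcal M$, and let $A$ be an $\overline{\mathcal O}$-algebra with action maps $\xi_m\colon \overline{\mathcal O}(m)\,\square\,A^{(m)}\to A$. The (left module) enveloping algebra $\overline UA$ is the coequalizer $$\coprod_{m\ge 0}\overline{\mathcal O}(m+1)\,\square\,\Bigl(\coprod_{j\ge0}\overline{\mathcal O}(j)\,\square\,A^{(j)}\Bigr)^{(m)}\rightrightarrows\coprod_{m\ge 0}\overline{\mathcal O}(m+1)\,\square\,A^{(m)}\to\overline UA$$ of the map induced by the action maps $\xi_j$ and the map induced by the operadic compositions $\Gamma^{m+1}_{j_1,\dots,j_m,1}(-;-,\dots,-,1)$, where the unit of the operad is inserted in the last input. **Proposition.** 1. $\overline UA$ has a $\square$-monoid structure whose unit is induced by $\mathbf 1\to\overline{\mathcal O}(1)$ and whose multiplication is induced by the maps $$(\overline{\mathcal O}(m+1)\,\square\,A^{(m)})\,\square\,(\overline{\mathcal O}(n+1)\,\square\,A^{(n)})\to\overline{\mathcal O}(m+n+1)\,\square\,A^{(m+n)}$$ given by $\circ_{m+1}=\Gamma^{m+1}_{1,\dots,1,n+1}(-;1,\dots,1,-)$,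 and $A$ has a left $\overline UA$-module structure induced by the maps $\xi_{m+1}\colon(\overline{\mathcal O}(m+1)\,\square\,A^{(m)})\,\square\,A\to A$. 2. With these structures, the composite $$\overline UA\cong\overline UA\,\square\,\mathbf 1\to\overline UA\,\square\,A\to A$$ of the map induced by $\mathbf 1\cong L\overline{\mathcal C}_1(0)\xrightarrow{\xi_0}A$ and the module action is a map of left $\overline UA$-modules and is a homotopy equivalence in $\mathcal M$. -/

import Mathlib

open CategoryTheory MonoidalCategory CartesianMonoidalCategory Limits

universe w v u

noncomputable section

namespace LittleIntervals

/-! ## Tuples of natural numbers and iterated products -/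

/-- An `m`-tuple `(j₁, …, j_m)` of natural numbers, built up from left to right. -/
inductive Arities : ℕ → Type
  | nil : Arities 0
  | snoc {m : ℕ} (j : Arities m) (a : ℕ) : Arities (m + 1)

namespace Arities

/-- The sum `j₁ + ⋯ + j_m`. -/
def sum : {m : ℕ} → Arities m → ℕ
  | _, nil => 0
  | _, snoc j a => j.sum + a

/-- The constant tuple `(1, …, 1)`. -/
def ones : (m : ℕ) → Arities m
  | 0 => nil
  | m + 1 => snoc (ones m) 1

theorem sum_ones : (m : ℕ) → (ones m).sum = m
  | 0 => rfl
  | m + 1 => congrArg (· + 1) (sum_ones m)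

/-- The list of entries, in reverse order. -/
def toList : {m : ℕ} → Arities m → List ℕ
  | _, nil => []
  | _, snoc j a => a :: j.toList

theorem toList_injective : {m : ℕ} → Function.Injective (toList : Arities m → List ℕ)
  | _, nil, nil, _ => rfl
  | _, snoc j a, snoc k b, h => by
    simp only [toList, List.cons.injEq] at h
    rw [h.1, toList_injective h.2]

instance (m : ℕ) : Countable (Arities m) := toList_injective.countable

end Arities

section Powers

variable {C : Type u} [Category.{v} C] [MonoidalCategory C]

/-- The product `X j₁ ⊗ ⋯ ⊗ X j_m`, bracketed from the left; the empty product is the unit. -/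
def tensorFam (X : ℕ → C) : {m : ℕ} → Arities m → C
  | _, .nil => 𝟙_ C
  | _, .snoc j a => tensorFam X j ⊗ X a

/-- The power `X^(m) = X ⊗ ⋯ ⊗ X`, bracketed from the left. -/
def tensorPow (X : C) : ℕ → C
  | 0 => 𝟙_ C
  | m + 1 => tensorPow X m ⊗ X

/-- The map `f j₁ ⊗ ⋯ ⊗ f j_m : X j₁ ⊗ ⋯ ⊗ X j_m ⟶ Y^(m)`. -/
def tensorFamToPow {X : ℕ → C} {Y : C} (f : ∀ n, X n ⟶ Y) :
    {m : ℕ} → (j : Arities m) → (tensorFam X j ⟶ tensorPow Y m)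
  | _, .nil => 𝟙 (𝟙_ C)
  | _, .snoc j a => tensorFamToPow f j ⊗ₘ f a

/-- The canonical isomorphism `X^(a) ⊗ X^(b) ⟶ X^(a + b)`. -/
def tensorPowAdd (X : C) (a : ℕ) : (b : ℕ) → (tensorPow X a ⊗ tensorPow X b ⟶ tensorPow X (a + b))
  | 0 => (ρ_ (tensorPow X a)).hom
  | b + 1 => (α_ (tensorPow X a) (tensorPow X b) X).inv ≫ tensorPowAdd X a b ▷ X

/-- The canonical isomorphism `X^(j₁) ⊗ ⋯ ⊗ X^(j_m) ⟶ X^(j₁ + ⋯ + j_m)`. -/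
def tensorPowFlatten (X : C) :
    {m : ℕ} → (j : Arities m) → (tensorFam (tensorPow X) j ⟶ tensorPow X j.sum)
  | _, .nil => 𝟙 (𝟙_ C)
  | _, .snoc j a =>
      tensorPowFlatten X j ▷ tensorPow X a ≫ tensorPowAdd X j.sum a

/-- The symmetry isomorphism
`(X j₁ ⊗ Y j₁) ⊗ ⋯ ⊗ (X j_m ⊗ Y j_m) ⟶ (X j₁ ⊗ ⋯ ⊗ X j_m) ⊗ (Y j₁ ⊗ ⋯ ⊗ Y j_m)`
which keeps the order of the `X`'s and of the `Y`'s. -/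
def unshuffle [BraidedCategory C] (X Y : ℕ → C) :
    {m : ℕ} → (j : Arities m) →
      (tensorFam (fun n => X n ⊗ Y n) j ⟶ tensorFam X j ⊗ tensorFam Y j)
  | _, .nil => (λ_ (𝟙_ C)).inv
  | _, .snoc j a =>
      unshuffle X Y j ▷ (X a ⊗ Y a) ≫ tensorμ (tensorFam X j) (tensorFam Y j) (X a) (Y a)

/-- The comparison map `F (X j₁) ⊗ ⋯ ⊗ F (X j_m) ⟶ F (X j₁ ⊗ ⋯ ⊗ X j_m)` of a monoidal functor. -/
def tensorFamComparison {D : Type*} [Category* D] [MonoidalCategory D] (F : C ⥤ D) [F.Monoidal]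
    (X : ℕ → C) : {m : ℕ} → (j : Arities m) →
      (tensorFam (fun n => F.obj (X n)) j ⟶ F.obj (tensorFam X j))
  | _, .nil => Functor.LaxMonoidal.ε F
  | _, .snoc j a => tensorFamComparison F X j ▷ F.obj (X a) ≫ Functor.LaxMonoidal.μ F _ _

end Powers

/-! ## Non-symmetric operads, algebras, enveloping algebras -/

/-- The data of a non-symmetric operad `O` in a monoidal category: its objects `O(m)`, its unit map
`1 ⟶ O(1)` and its composition maps `Γ`.  This is all that the definitions of algebras and of
enveloping algebras refer to; the associativity and unit laws hold for the operad of little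
intervals constructed below. -/
structure OperadData (C : Type u) [Category.{v} C] [MonoidalCategory C] where
  /-- The object `O(m)` of `m`-ary operations. -/
  obj : ℕ → C
  /-- The unit map. -/
  one : 𝟙_ C ⟶ obj 1
  /-- The composition `O(m) ⊗ (O(j₁) ⊗ ⋯ ⊗ O(j_m)) ⟶ O(j₁ + ⋯ + j_m)`. -/
  comp : ∀ {m : ℕ} (j : Arities m), obj m ⊗ tensorFam obj j ⟶ obj j.sum

namespace OperadData

variable {C : Type u} [Category.{v} C] [MonoidalCategory C]

/-- The image `F O` of an operad under a strong monoidal functor `F`. -/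
def map {D : Type*} [Category* D] [MonoidalCategory D] (O : OperadData C) (F : C ⥤ D)
    [F.Monoidal] : OperadData D where
  obj m := F.obj (O.obj m)
  one := Functor.LaxMonoidal.ε F ≫ F.map O.one
  comp {m} j :=
    F.obj (O.obj m) ◁ tensorFamComparison F O.obj j ≫ Functor.LaxMonoidal.μ F _ _ ≫
      F.map (O.comp j)

variable (O : OperadData C)

/-- The map `1 ⟶ O(1) ⊗ ⋯ ⊗ O(1)` given by the unit of the operad in every factor. -/
def oneFam : (m : ℕ) → (𝟙_ C ⟶ tensorFam O.obj (Arities.ones m))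
  | 0 => 𝟙 (𝟙_ C)
  | m + 1 => (λ_ (𝟙_ C)).inv ≫ (oneFam m ⊗ₘ O.one)

/-- The map `Γ(-; -, …, -, 1) : O(m+1) ⊗ (O(j₁) ⊗ ⋯ ⊗ O(j_m)) ⟶ O(j₁ + ⋯ + j_m + 1)`
which plugs the operad unit into the last input. -/
def compOne {m : ℕ} (j : Arities m) : O.obj (m + 1) ⊗ tensorFam O.obj j ⟶ O.obj (j.sum + 1) :=
  O.obj (m + 1) ◁ ((ρ_ (tensorFam O.obj j)).inv ≫ tensorFam O.obj j ◁ O.one) ≫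
    O.comp (Arities.snoc j 1)

/-- The partial composition `∘_{m+1} = Γ(-; 1, …, 1, -) : O(m+1) ⊗ O(n+1) ⟶ O(m+n+1)`
in the last input. -/
def compLast (m n : ℕ) : O.obj (m + 1) ⊗ O.obj (n + 1) ⟶ O.obj (m + n + 1) :=
  O.obj (m + 1) ◁ ((λ_ (O.obj (n + 1))).inv ≫ O.oneFam m ▷ O.obj (n + 1)) ≫
    O.comp (Arities.snoc (Arities.ones m) (n + 1)) ≫
      eqToHom (congrArg (fun k => O.obj (k + (n + 1))) (Arities.sum_ones m))

end OperadData

section Algebras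

variable {M : Type u} [Category.{v} M] [MonoidalCategory M] [SymmetricCategory M]

/-- An algebra over a non-symmetric operad.  In the associativity law both sides are precomposed
with the symmetry isomorphism that brings each `A^(j_i)` next to `O(j_i)`. -/
structure OperadAlgebra (O : OperadData M) where
  /-- The underlying object `A`. -/
  X : M
  /-- The action maps `ξ_m : O(m) ⊗ A^(m) ⟶ A`. -/
  act : ∀ m : ℕ, O.obj m ⊗ tensorPow X m ⟶ X
  act_comp : ∀ {m : ℕ} (j : Arities m),
    O.obj m ◁ tensorFamToPow act j ≫ act m =
      O.obj m ◁ (unshuffle O.obj (tensorPow X) j ≫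
          tensorFam O.obj j ◁ tensorPowFlatten X j) ≫
        (α_ (O.obj m) (tensorFam O.obj j) (tensorPow X j.sum)).inv ≫
          O.comp j ▷ tensorPow X j.sum ≫ act j.sum
  act_one : O.one ▷ X ≫ O.obj 1 ◁ (λ_ X).inv ≫ act 1 = (λ_ X).hom

namespace OperadAlgebra

variable {O : OperadData M} (A : OperadAlgebra O)

/-- The object `O(m+1) ⊗ A^(m)`. -/
def envSummand (m : ℕ) : M := O.obj (m + 1) ⊗ tensorPow A.X m

/-- The object `O(m+1) ⊗ ((O(j₁) ⊗ A^(j₁)) ⊗ ⋯ ⊗ (O(j_m) ⊗ A^(j_m)))`. The coproduct of these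
objects over all `m` and all `(j₁, …, j_m)` is `∐ₘ O(m+1) ⊗ (∐ⱼ O(j) ⊗ A^(j))^(m)`. -/
def envRelation (s : Σ m : ℕ, Arities m) : M :=
  O.obj (s.1 + 1) ⊗ tensorFam (fun n => O.obj n ⊗ tensorPow A.X n) s.2

/-- The map given by the action maps `O(j_i) ⊗ A^(j_i) ⟶ A`. -/
def envAct (s : Σ m : ℕ, Arities m) : A.envRelation s ⟶ A.envSummand s.1 :=
  O.obj (s.1 + 1) ◁ tensorFamToPow A.act s.2

/-- The map given by the operadic multiplication `Γ(-; -, …, -, 1)`. -/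
def envComp (s : Σ m : ℕ, Arities m) : A.envRelation s ⟶ A.envSummand s.2.sum :=
  O.obj (s.1 + 1) ◁ (unshuffle O.obj (tensorPow A.X) s.2 ≫
      tensorFam O.obj s.2 ◁ tensorPowFlatten A.X s.2) ≫
    (α_ (O.obj (s.1 + 1)) (tensorFam O.obj s.2) (tensorPow A.X s.2.sum)).inv ≫
      O.compOne s.2 ▷ tensorPow A.X s.2.sum

variable [HasCountableColimits M]

/-- The underlying object of the (left module) enveloping algebra of `A`, a coequalizer of
two maps `∐ₘ O(m+1) ⊗ (∐ⱼ O(j) ⊗ A^(j))^(m) ⇉ ∐ₘ O(m+1) ⊗ A^(m)`. -/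
def env : M :=
  coequalizer
    (Sigma.desc fun s => A.envAct s ≫ Sigma.ι A.envSummand s.1)
    (Sigma.desc fun s => A.envComp s ≫ Sigma.ι A.envSummand s.2.sum)

/-- The canonical map `O(m+1) ⊗ A^(m) ⟶ env A`. -/
def envι (m : ℕ) : O.obj (m + 1) ⊗ tensorPow A.X m ⟶ A.env :=
  Sigma.ι A.envSummand m ≫ coequalizer.π _ _

/-- The multiplication
`(O(m+1) ⊗ A^(m)) ⊗ (O(n+1) ⊗ A^(n)) ⟶ O(m+n+1) ⊗ A^(m+n)` given by `∘_{m+1}`. -/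
def envMulSummand (m n : ℕ) :
    (O.obj (m + 1) ⊗ tensorPow A.X m) ⊗ (O.obj (n + 1) ⊗ tensorPow A.X n) ⟶
      O.obj (m + n + 1) ⊗ tensorPow A.X (m + n) :=
  tensorμ (O.obj (m + 1)) (tensorPow A.X m) (O.obj (n + 1)) (tensorPow A.X n) ≫
    (O.compLast m n ⊗ₘ tensorPowAdd A.X m n)

/-- The enveloping algebra structure: the monoid structure on `env A` induced by the operad unit
and by `∘_{m+1}`, and the left `env A`-module structure on `A` induced by the action maps
`O(m+1) ⊗ A^(m) ⊗ A ⟶ A`.  Both are determined by the equations below. -/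
structure EnvStructure where
  mon : MonObj A.env
  one_eq : mon.one = O.one ≫ (ρ_ (O.obj 1)).inv ≫ A.envι 0
  ι_mul : ∀ m n : ℕ,
    (A.envι m ⊗ₘ A.envι n) ≫ mon.mul = A.envMulSummand m n ≫ A.envι (m + n)
  mod : ModObj A.env A.X
  ι_smul : ∀ m : ℕ, A.envι m ▷ A.X ≫ mod.smul =
    (α_ (O.obj (m + 1)) (tensorPow A.X m) A.X).hom ≫ A.act (m + 1)

/-- The map `env A ≅ env A ⊗ 1 ⟶ env A ⊗ A ⟶ A` induced by a map `e : 1 ⟶ A` and the action. -/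
def EnvStructure.orbitMap {A : OperadAlgebra O} (E : A.EnvStructure) (e : 𝟙_ M ⟶ A.X) :
    A.env ⟶ A.X :=
  (ρ_ A.env).inv ≫ A.env ◁ e ≫ E.mod.smul

/-- `f : env A ⟶ A` is a map of left `env A`-modules, where `env A` acts on itself by left
multiplication. -/
def EnvStructure.IsModuleMap {A : OperadAlgebra O} (E : A.EnvStructure) (f : A.env ⟶ A.X) : Prop :=
  @IsModHom M _ _ M _ _ A.env E.mon A.env A.X (@ModObj.regular M _ _ A.env E.mon) E.mod f

end OperadAlgebra

end Algebras

/-! ## Spaces and the operad of little intervals -/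

/-- The class of spaces `P` contains the convex subsets of finite-dimensional real vector spaces.
This holds for the usual convenient categories of spaces, such as compactly generated spaces,
compactly generated weak Hausdorff spaces, or delta-generated spaces. -/
class ContainsConvexSets (P : ObjectProperty TopCat.{w}) : Prop where
  prop_of_convex : ∀ (E : Type) [NormedAddCommGroup E] [NormedSpace ℝ E] [FiniteDimensional ℝ E]
    (K : Set E), Convex ℝ K → P (TopCat.of (ULift.{w} K))

section Spaces

variable (P : ObjectProperty TopCat.{w})

variable {P} in
/-- A constant map. -/
def constMap {X Y : P.FullSubcategory} (y : Y.obj) : X ⟶ Y :=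
  ObjectProperty.homMk (TopCat.ofHom (ContinuousMap.const _ y))

variable [ContainsConvexSets P]

/-- The unit interval `[0, 1]` as a space. -/
def unitInterval : P.FullSubcategory where
  obj := TopCat.of (ULift.{w} (Set.Icc (0 : ℝ) 1))
  property := ContainsConvexSets.prop_of_convex ℝ _ (convex_Icc 0 1)

/-- Lists `[x₁, y₁], …, [x_m, y_m]` of subintervals of `[0, 1]` of positive length, which do not
overlap except at their endpoints and are listed in their natural order. A subinterval `[x, y]`
stands for the affine embedding `t ↦ x + (y - x) t` and is recorded as the pair `(x, y)`. -/
def intervalSet (m : ℕ) : Set (Fin m → ℝ × ℝ) :=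
  {c | (∀ i, 0 ≤ (c i).1 ∧ (c i).1 < (c i).2 ∧ (c i).2 ≤ 1) ∧
    ∀ i k, i < k → (c i).2 ≤ (c k).1}

theorem convex_intervalSet (m : ℕ) : Convex ℝ (intervalSet m) := by
  intro c hc d hd a b ha hb hab
  have key : ∀ x y x' y' : ℝ, x ≤ y → x' ≤ y' → a * x + b * x' ≤ a * y + b * y' :=
    fun x y x' y' h h' =>
      add_le_add (mul_le_mul_of_nonneg_left h ha) (mul_le_mul_of_nonneg_left h' hb)
  refine ⟨fun i => ?_, fun i k hik => ?_⟩
  · simp only [Pi.add_apply, Pi.smul_apply, Prod.fst_add, Prod.snd_add, Prod.smul_fst,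
      Prod.smul_snd, smul_eq_mul]
    obtain ⟨h1, h2, h3⟩ := hc.1 i
    obtain ⟨h1', h2', h3'⟩ := hd.1 i
    refine ⟨?_, ?_, ?_⟩
    · have := key _ _ _ _ h1 h1'
      linarith
    · rcases ha.eq_or_lt with h0 | h0
      · have hb1 : b = 1 := by linarith
        subst hb1
        rw [← h0]
        linarith
      · have := mul_lt_mul_of_pos_left h2 h0
        have := mul_le_mul_of_nonneg_left h2'.le hb
        linarith
    · have := key _ _ _ _ h3 h3'
      linarith
  · simp only [Pi.add_apply, Pi.smul_apply, Prod.fst_add, Prod.snd_add, Prod.smul_fst,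
      Prod.smul_snd, smul_eq_mul]
    exact key _ _ _ _ (hc.2 i k hik) (hd.2 i k hik)

/-- The space of `m` little intervals in their natural order. -/
def intervals (m : ℕ) : P.FullSubcategory where
  obj := TopCat.of (ULift.{w} (intervalSet m))
  property := ContainsConvexSets.prop_of_convex _ _ (convex_intervalSet m)

variable {P} in
/-- The list of pairs of endpoints of a point of the space of little intervals. -/
def endpoints {m : ℕ} (c : (intervals P m).obj) : Fin m → ℝ × ℝ :=
  (ULift.down (α := intervalSet m) c).1

variable {P} in
theorem endpoints_mem {m : ℕ} (c : (intervals P m).obj) : endpoints c ∈ intervalSet m :=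
  (ULift.down (α := intervalSet m) c).2

variable {P} in
theorem continuous_endpoints {m : ℕ} : Continuous (endpoints (P := P) (m := m)) :=
  continuous_subtype_val.comp continuous_uliftDown

/-- The composite of the affine embeddings corresponding to two intervals. -/
def rescale (p q : ℝ × ℝ) : ℝ × ℝ := (p.1 + (p.2 - p.1) * q.1, p.1 + (p.2 - p.1) * q.2)

theorem rescale_mem {p q : ℝ × ℝ} (hp : 0 ≤ p.1 ∧ p.1 < p.2 ∧ p.2 ≤ 1)
    (hq : 0 ≤ q.1 ∧ q.1 < q.2 ∧ q.2 ≤ 1) :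
    p.1 ≤ (rescale p q).1 ∧ (rescale p q).1 < (rescale p q).2 ∧ (rescale p q).2 ≤ p.2 := by
  have hpos := sub_pos.2 hp.2.1
  refine ⟨?_, ?_, ?_⟩ <;> simp only [rescale]
  · have := mul_nonneg hpos.le hq.1
    linarith
  · have := mul_lt_mul_of_pos_left hq.2.1 hpos
    linarith
  · have := mul_le_mul_of_nonneg_left hq.2.2 hpos.le
    linarith

theorem rescale_le {p q r : ℝ × ℝ} (hp : p.1 ≤ p.2) (h : q.2 ≤ r.1) :
    (rescale p q).2 ≤ (rescale p r).1 := by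
  have := mul_le_mul_of_nonneg_left h (sub_nonneg.2 hp)
  simp only [rescale]
  linarith

theorem init_mem {m : ℕ} {c : Fin (m + 1) → ℝ × ℝ} (hc : c ∈ intervalSet (m + 1)) :
    (fun i : Fin m => c i.castSucc) ∈ intervalSet m :=
  ⟨fun _ => hc.1 _, fun _ _ h => hc.2 _ _ (Fin.castSucc_lt_castSucc_iff.2 h)⟩

variable [CartesianMonoidalCategory P.FullSubcategory]

/-- The composition of little intervals: the intervals of the `i`-th factor of `d` are composed
with the `i`-th interval of `c`, and the resulting lists are concatenated. -/
def composeFun : {m : ℕ} → (j : Arities m) → (Fin m → ℝ × ℝ) →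
    (tensorFam (intervals P) j).obj → Fin j.sum → ℝ × ℝ
  | _, .nil, _, _ => Fin.elim0
  | m + 1, .snoc j a, c, d =>
      Fin.append
        (composeFun j (fun i => c i.castSucc)
          ((fst (tensorFam (intervals P) j) (intervals P a)).hom d))
        (fun i => rescale (c (Fin.last m))
          (endpoints ((snd (tensorFam (intervals P) j) (intervals P a)).hom d) i))

theorem composeFun_bounds : {m : ℕ} → (j : Arities m) → (c : Fin m → ℝ × ℝ) →
    (hc : c ∈ intervalSet m) → (d : (tensorFam (intervals P) j).obj) → (i : Fin j.sum) →
    ∃ k, (c k).1 ≤ (composeFun P j c d i).1 ∧ (composeFun P j c d i).2 ≤ (c k).2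
  | _, .nil, _, _, _, i => i.elim0
  | m + 1, .snoc j a, c, hc, d, i => by
    refine Fin.addCases (fun i => ?_) (fun i => ?_) i
    · obtain ⟨k, hk⟩ := composeFun_bounds j (fun i => c i.castSucc) (init_mem hc)
        ((fst (tensorFam (intervals P) j) (intervals P a)).hom d) i
      refine ⟨k.castSucc, ?_⟩
      simpa only [composeFun, Fin.append_left] using hk
    · refine ⟨Fin.last m, ?_⟩
      have h := rescale_mem (hc.1 (Fin.last m))
        ((endpoints_mem ((snd (tensorFam (intervals P) j) (intervals P a)).hom d)).1 i)
      simpa only [composeFun, Fin.append_right] using ⟨h.1, h.2.2⟩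

theorem composeFun_mem : {m : ℕ} → (j : Arities m) → (c : Fin m → ℝ × ℝ) →
    (hc : c ∈ intervalSet m) → (d : (tensorFam (intervals P) j).obj) →
    composeFun P j c d ∈ intervalSet j.sum
  | _, .nil, _, _, _ => ⟨fun i => i.elim0, fun i => i.elim0⟩
  | m + 1, .snoc j a, c, hc, d => by
    have hd := endpoints_mem ((snd (tensorFam (intervals P) j) (intervals P a)).hom d)
    have ih := composeFun_mem j (fun i => c i.castSucc) (init_mem hc)
      ((fst (tensorFam (intervals P) j) (intervals P a)).hom d)
    have hl := hc.1 (Fin.last m)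
    constructor
    · refine fun i => Fin.addCases (fun i => ?_) (fun i => ?_) i
      · simpa only [composeFun, Fin.append_left] using ih.1 i
      · have h := rescale_mem hl (hd.1 i)
        simpa only [composeFun, Fin.append_right] using
          ⟨hl.1.trans h.1, h.2.1, h.2.2.trans hl.2.2⟩
    · refine fun i k => Fin.addCases (fun i => ?_) (fun i => ?_) i <;>
        refine Fin.addCases (fun k => ?_) (fun k => ?_) k <;> intro hik
      · simpa only [composeFun, Fin.append_left] using ih.2 i k hik
      · obtain ⟨l, hl'⟩ := composeFun_bounds P j (fun i => c i.castSucc) (init_mem hc)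
          ((fst (tensorFam (intervals P) j) (intervals P a)).hom d) i
        have h1 := hc.2 l.castSucc (Fin.last m) (Fin.castSucc_lt_last l)
        have h := rescale_mem hl (hd.1 k)
        simpa only [composeFun, Fin.append_left, Fin.append_right] using
          hl'.2.trans (h1.trans h.1)
      · have hlt : j.sum + i.val < k.val := hik
        exact absurd hlt (by have := k.isLt; omega)
      · have h := rescale_le hl.2.1.le (hd.2 i k
          (Nat.lt_of_add_lt_add_left (n := j.sum) hik))
        simpa only [composeFun, Fin.append_right] using h

theorem continuous_composeFun {T : Type*} [TopologicalSpace T] : {m : ℕ} → (j : Arities m) →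
    (c : T → Fin m → ℝ × ℝ) → Continuous c → (d : T → (tensorFam (intervals P) j).obj) →
    Continuous d → Continuous fun t => composeFun P j (c t) (d t)
  | _, .nil, _, _, _, _ => continuous_const
  | m + 1, .snoc j a, c, hc, d, hd => by
    have ih := continuous_composeFun j (fun t i => c t i.castSucc) (by fun_prop)
      (fun t => (fst (tensorFam (intervals P) j) (intervals P a)).hom (d t))
      ((fst (tensorFam (intervals P) j) (intervals P a)).hom.hom.continuous.comp hd)
    have he : Continuous fun t =>
        endpoints ((snd (tensorFam (intervals P) j) (intervals P a)).hom (d t)) :=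
      continuous_endpoints.comp
        ((snd (tensorFam (intervals P) j) (intervals P a)).hom.hom.continuous.comp hd)
    refine continuous_pi fun i => Fin.addCases (fun i => ?_) (fun i => ?_) i
    · simp only [composeFun, Fin.append_left]
      exact (continuous_apply i).comp ih
    · simp only [composeFun, Fin.append_right, rescale]
      fun_prop

/-- The non-symmetric operad of little intervals (little `1`-cubes), with all operations
numbered in the natural order of the subintervals. -/
def littleIntervals : OperadData P.FullSubcategory where
  obj := intervals P
  one := constMap (ULift.up ⟨fun _ => (0, 1), by
    refine ⟨fun _ => by norm_num, fun i k h => ?_⟩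
    exact absurd h (by rw [Subsingleton.elim i k]; exact lt_irrefl k)⟩)
  comp {m} j := ObjectProperty.homMk (TopCat.ofHom
    { toFun := fun p => ULift.up
        ⟨composeFun P j
          (endpoints ((fst (intervals P m) (tensorFam (intervals P) j)).hom p))
          ((snd (intervals P m) (tensorFam (intervals P) j)).hom p),
         composeFun_mem P j _ (endpoints_mem _) _⟩
      continuous_toFun := by
        refine continuous_uliftUp.comp (Continuous.subtype_mk ?_ _)
        exact continuous_composeFun P j _
          (continuous_endpoints.comp
            (fst (intervals P m) (tensorFam (intervals P) j)).hom.hom.continuous) _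
          (snd (intervals P m) (tensorFam (intervals P) j)).hom.hom.continuous })

/-- The identification `1 ≅ C(0)` of the one-point space with the space of empty lists. -/
def emptyIntervals : 𝟙_ P.FullSubcategory ⟶ intervals P 0 :=
  constMap (ULift.up ⟨Fin.elim0, fun i => i.elim0, fun i => i.elim0⟩)

end Spaces

/-! ## Algebras over little intervals in an enriched category, and homotopies -/

section Enriched

variable {P : ObjectProperty TopCat.{w}} [ContainsConvexSets P]
  [CartesianMonoidalCategory P.FullSubcategory]
  {M : Type u} [Category.{v} M] [MonoidalCategory M]
  (L : P.FullSubcategory ⥤ M) [L.Monoidal]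

/-- The unit map `1 ≅ L(1) ≅ L(C(0)) ≅ L(C(0)) ⊗ A^(0) ⟶ A` of an algebra over `L C`. -/
def algebraUnit [SymmetricCategory M] (A : OperadAlgebra ((littleIntervals P).map L)) :
    𝟙_ M ⟶ A.X :=
  Functor.LaxMonoidal.ε L ≫ L.map (emptyIntervals P) ≫ (ρ_ (L.obj (intervals P 0))).inv ≫ A.act 0

/-- The inclusion `X ≅ X ⊗ L(1) ⟶ X ⊗ L([0, 1])` at a point `t` of the unit interval. -/
def inclAt (X : M) (t : Set.Icc (0 : ℝ) 1) : X ⟶ X ⊗ L.obj (unitInterval P) :=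
  (ρ_ X).inv ≫ X ◁ (Functor.LaxMonoidal.ε L ≫
    L.map (constMap (Y := unitInterval P) (ULift.up t)))

/-- A homotopy from `f` to `g`: a map `X ⊗ L([0, 1]) ⟶ Y` which restricts to `f` and `g`. -/
def Homotopic {X Y : M} (f g : X ⟶ Y) : Prop :=
  ∃ H : X ⊗ L.obj (unitInterval P) ⟶ Y, inclAt L X 0 ≫ H = f ∧ inclAt L X 1 ≫ H = g

/-- `f` is a homotopy equivalence with respect to the tensors with spaces given by `L`. -/
def IsHomotopyEquivalence {X Y : M} (f : X ⟶ Y) : Prop :=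
  ∃ g : Y ⟶ X, Homotopic L (f ≫ g) (𝟙 X) ∧ Homotopic L (g ≫ f) (𝟙 Y)

end Enriched

end LittleIntervals

end

/-! A point of `env A` is a class `[c; a]` of intervals `c = (c₁, …, c_m, r)` and elements `a = (a₁,
…, a_m)`; the last interval `r` is a free slot. The relations let an operation applied to some of
the `aᵢ` be moved into `c`, always with the operad unit in the slot.

Monoid and module. The product plugs the second operation into the slot of the first. Since `M` is
closed and symmetric, `⊗` preserves the coequalizer in each variable, so everything is defined and
checked on summands. Two relations, for tuples `j` and `k`, multiply to the relation for the
concatenation of `j` and `k`; taking one tuple to be `(1, …, 1)` and inserting operad units there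
gives compatibility in one variable at a time (`relationAct_summandMul`, `summandMul_relationAct`).
Only the operad laws in `LastInputLaws` are needed. They pass through a braided strong monoidal
functor (`OperadData.LastInputLaws.map`) and are checked for little intervals on lists of endpoints
(`lastInputLaws_littleIntervals`). On the module side everything follows from associativity of the
action at the tuples `(1, …, 1, q)` (`act_last`) and `(j₁, …, j_m, 1)` (`envAct_act`).

Homotopy equivalence. The orbit map sends `[c; a]` to `ξ_m(c₁, …, c_m; a)`: the nullary operation
fills the slot and `r` is forgotten. The inverse sends `a` to `[[0, 1/2], [1/2, 1]; a]`. Going from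
`A` to `A` the composite is the action of `[0, 1/2]`, which is joined to the unit `[0, 1]` by moving
the right endpoint. Going from `env A` to itself, the relation turns `[halves; ξ_m(c₁, …, c_m; a)]`
into `[c₁/2, …, c_m/2, [1/2, 1]; a]`, and the straight line to `c` stays among little intervals by
convexity. Along it the first `m` intervals are rescaled by the common factor `(1 + t)/2`, so they
change by composition on the outside, and `r` moves independently of them; hence the line commutes
with the relations (`contract_composeOne`) and descends to `env A`. -/

noncomputable section
namespace LittleIntervals

/-! ### Concatenation of tuples of arities -/

namespace Arities

/-- Concatenation of tuples. -/
def append {m : ℕ} (j : Arities m) : {n : ℕ} → Arities n → Arities (m + n)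
  | _, nil => j
  | _, snoc k a => snoc (j.append k) a

theorem sum_append {m : ℕ} (j : Arities m) : {n : ℕ} → (k : Arities n) →
    (j.append k).sum = j.sum + k.sum
  | _, nil => rfl
  | _, snoc k a => (congrArg (· + a) (sum_append j k)).trans (Nat.add_assoc _ _ _)

end Arities

/-! ### Transport along equalities of arities -/

section Casts

variable {C : Type u} [Category.{v} C]

/-- The identification of two members of a family of objects with equal indices. -/
def castObj (F : ℕ → C) {m n : ℕ} (h : m = n) : F m ⟶ F n := eqToHom (congrArg F h)

@[simp] theorem castObj_rfl (F : ℕ → C) {m : ℕ} (h : m = m) : castObj F h = 𝟙 _ := rfl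

@[simp]
theorem castObj_trans (F : ℕ → C) {m n k : ℕ} (h : m = n) (h' : n = k) :
    castObj F h ≫ castObj F h' = castObj F (h.trans h') := by subst h h'; simp

@[simp]
theorem castObj_trans_assoc (F : ℕ → C) {m n k : ℕ} (h : m = n) (h' : n = k) {Z : C}
    (f : F k ⟶ Z) : castObj F h ≫ castObj F h' ≫ f = castObj F (h.trans h') ≫ f := by
  subst h h'; simp

end Casts

/-! ### Powers and iterated products in a monoidal category -/

section Tuples

variable {C : Type u} [Category.{v} C] [MonoidalCategory C]

theorem castObj_tensorPow_succ (X : C) {m n : ℕ} (h : m = n) (h' : m + 1 = n + 1) :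
    castObj (tensorPow X) h' = castObj (tensorPow X) h ▷ X := by
  subst h; simp; rfl

theorem castObj_tensorHom_tensorPowAdd (X : C) {a a' b b' : ℕ} (ha : a = a') (hb : b = b') :
    (castObj (tensorPow X) ha ⊗ₘ castObj (tensorPow X) hb) ≫ tensorPowAdd X a' b' =
      tensorPowAdd X a b ≫ castObj (tensorPow X) (by rw [ha, hb]) := by
  subst ha hb; simp

theorem tensorPowAdd_assoc (X : C) (a b : ℕ) : (c : ℕ) →
    tensorPowAdd X a b ▷ tensorPow X c ≫ tensorPowAdd X (a + b) c =
      (α_ _ _ _).hom ≫ tensorPow X a ◁ tensorPowAdd X b c ≫ tensorPowAdd X a (b + c) ≫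
        castObj (tensorPow X) (Nat.add_assoc a b c).symm
  | 0 => by dsimp only [tensorPowAdd, tensorPow, castObj_rfl, Nat.add_zero]; simp
  | c + 1 => by
    have ih := tensorPowAdd_assoc X a b c
    rw [castObj_tensorPow_succ X (Nat.add_assoc a b c).symm]
    -- Powers grow on the right and addition on `ℕ` recurses on its second argument, so every
    -- exponent ending in `c + 1` unfolds definitionally; only the reassociation `a + (b + c)` needs
    -- a cast.
    change tensorPowAdd X a b ▷ (tensorPow X c ⊗ X) ≫ (α_ _ _ _).inv ≫
      tensorPowAdd X (a + b) c ▷ X = (α_ _ _ (tensorPow X c ⊗ X)).hom ≫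
        tensorPow X a ◁ ((α_ _ _ _).inv ≫ tensorPowAdd X b c ▷ X) ≫
          ((α_ _ (tensorPow X (b + c)) X).inv ≫ tensorPowAdd X a (b + c) ▷ X) ≫
            castObj (tensorPow X) (Nat.add_assoc a b c).symm ▷ X
    rw [associator_inv_naturality_left_assoc, ← comp_whiskerRight, ih]
    simp

theorem tensorPowAdd_zero_left (X : C) : (n : ℕ) →
    tensorPowAdd X 0 n = (λ_ _).hom ≫ castObj (tensorPow X) (Nat.zero_add n).symm
  | 0 => by dsimp only [tensorPowAdd, tensorPow, castObj_rfl]; simp [unitors_equal]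
  | n + 1 => by
    rw [castObj_tensorPow_succ X (Nat.zero_add n).symm]
    dsimp only [tensorPowAdd, tensorPow]
    simp [tensorPowAdd_zero_left X n]

/-- The canonical isomorphism `X ⟶ X^(1)`. -/
def toPowOne (X : C) : X ⟶ tensorPow X 1 := (λ_ X).inv

/-- `tensorPow X (n + 1)` is by definition `tensorPow X n ⊗ X`, so the detour through `X^(1)`
consists of unitors that cancel. -/
theorem castObj_tensorHom_tensorPowAdd_one (X : C) {m n : ℕ} (h : m = n) :
    (castObj (tensorPow X) h ⊗ₘ toPowOne X) ≫ tensorPowAdd X n 1 =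
      (castObj (tensorPow X) (congrArg (· + 1) h) : tensorPow X (m + 1) ⟶ _) := by
  subst h
  change (𝟙 _ ⊗ₘ (λ_ X).inv) ≫ (α_ _ _ _).inv ≫ (ρ_ _).hom ▷ X = 𝟙 (tensorPow X m ⊗ X)
  monoidal

/-- The canonical isomorphism `(X j₁ ⊗ ⋯ ⊗ X j_m) ⊗ (X k₁ ⊗ ⋯ ⊗ X k_n) ⟶ X j₁ ⊗ ⋯ ⊗ X k_n`. -/
def tensorFamAppend (X : ℕ → C) {m : ℕ} (j : Arities m) : {n : ℕ} → (k : Arities n) →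
    (tensorFam X j ⊗ tensorFam X k ⟶ tensorFam X (j.append k))
  | _, .nil => (ρ_ (tensorFam X j)).hom
  | _, .snoc k a =>
      (α_ (tensorFam X j) (tensorFam X k) (X a)).inv ≫ tensorFamAppend X j k ▷ X a

theorem tensorFamAppend_toPow {X : ℕ → C} {Y : C} (f : ∀ n, X n ⟶ Y) {m : ℕ} (j : Arities m) :
    {n : ℕ} → (k : Arities n) →
      tensorFamAppend X j k ≫ tensorFamToPow f (j.append k) =
        (tensorFamToPow f j ⊗ₘ tensorFamToPow f k) ≫ tensorPowAdd Y m n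
  | _, .nil => by
    dsimp only [tensorFamAppend, tensorFamToPow, tensorPowAdd, tensorFam, tensorPow,
      Arities.append, Nat.add_zero]
    simp
  | _, .snoc (m := n) k a => by
    have ih := tensorFamAppend_toPow f j k
    change ((α_ _ _ _).inv ≫ tensorFamAppend X j k ▷ X a) ≫
        (tensorFamToPow f (j.append k) ⊗ₘ f a) =
      (tensorFamToPow f j ⊗ₘ tensorFamToPow f k ⊗ₘ f a) ≫ (α_ _ _ _).inv ≫
        tensorPowAdd Y m n ▷ Y
    rw [associator_inv_naturality_assoc, Category.assoc, whiskerRight_comp_tensorHom, ih,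
      ← tensorHom_comp_whiskerRight]

theorem tensorFamAppend_flatten (X : C) {m : ℕ} (j : Arities m) : {n : ℕ} → (k : Arities n) →
    tensorFamAppend (tensorPow X) j k ≫ tensorPowFlatten X (j.append k) =
      (tensorPowFlatten X j ⊗ₘ tensorPowFlatten X k) ≫ tensorPowAdd X j.sum k.sum ≫
        castObj (tensorPow X) (Arities.sum_append j k).symm
  | _, .nil => by
    dsimp only [tensorFamAppend, tensorPowFlatten, tensorPowAdd, tensorFam, tensorPow,
      Arities.append, Arities.sum, Nat.add_zero]
    simp only [rightUnitor_naturality_assoc, tensorHom_id]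
    exact congrArg _ (Category.comp_id _).symm
  | _, .snoc k a => by
    have ih := tensorFamAppend_flatten X j k
    have h := tensorPowAdd_assoc X j.sum k.sum a
    have h' := castObj_tensorHom_tensorPowAdd X (Arities.sum_append j k).symm (rfl : a = a)
    change ((α_ _ _ _).inv ≫ tensorFamAppend (tensorPow X) j k ▷ tensorPow X a) ≫
        tensorPowFlatten X (j.append k) ▷ tensorPow X a ≫ tensorPowAdd X (j.append k).sum a =
      (tensorPowFlatten X j ⊗ₘ
        (tensorPowFlatten X k ▷ tensorPow X a ≫ tensorPowAdd X k.sum a)) ≫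
          tensorPowAdd X j.sum (k.sum + a) ≫ castObj (tensorPow X) _
    rw [Category.assoc, ← comp_whiskerRight_assoc, ih]
    simp only [castObj_rfl, tensorHom_id] at h'
    simp only [comp_whiskerRight, Category.assoc, h', reassoc_of% h, castObj_trans]
    rw [← tensorHom_comp_whiskerLeft_assoc, ← tensorHom_id, associator_naturality_assoc]
    simp

/-- The map `A^(n) ⟶ Z 1 ⊗ ⋯ ⊗ Z 1` given by a map `A ⟶ Z 1` in every factor. -/
def powToFam {A : C} {Z : ℕ → C} (e : A ⟶ Z 1) :
    (n : ℕ) → (tensorPow A n ⟶ tensorFam Z (Arities.ones n))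
  | 0 => 𝟙 (𝟙_ C)
  | n + 1 => powToFam e n ⊗ₘ e

/-- Applied with `e` the insertion of the operad unit and `f` the action maps: inserting units gives
a section of the first map of the coequalizer. -/
theorem powToFam_toPow {A : C} {Z : ℕ → C} (e : A ⟶ Z 1) (f : ∀ n, Z n ⟶ A)
    (h : e ≫ f 1 = 𝟙 A) : (n : ℕ) → powToFam e n ≫ tensorFamToPow f (Arities.ones n) = 𝟙 _
  | 0 => Category.id_comp _
  | n + 1 => by
    have ih := powToFam_toPow e f h n
    dsimp only [powToFam, tensorFamToPow, Arities.ones, tensorPow, tensorFam]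
    rw [tensorHom_comp_tensorHom, h, ih, id_tensorHom_id]

end Tuples

/-! ### Shuffling operations past algebra elements -/

section Braided

variable {C : Type u} [Category.{v} C] [MonoidalCategory C] [BraidedCategory C]

/-- Induction on `k`: the empty tuple is the right unit coherence of `tensorμ`, and one more factor
is its associativity coherence. -/
theorem tensorFamAppend_unshuffle (X Y : ℕ → C) {m : ℕ} (j : Arities m) :
    {n : ℕ} → (k : Arities n) →
      tensorFamAppend (fun n => X n ⊗ Y n) j k ≫ unshuffle X Y (j.append k) =
        (unshuffle X Y j ⊗ₘ unshuffle X Y k) ≫ tensorμ _ _ _ _ ≫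
          (tensorFamAppend X j k ⊗ₘ tensorFamAppend Y j k)
  | _, .nil => by
    have h := tensor_right_unitality (tensorFam X j) (tensorFam Y j)
    dsimp only [tensorFamAppend, unshuffle, tensorFam, Arities.append]
    rw [← rightUnitor_naturality, h, MonoidalCategory.tensorHom_def (unshuffle X Y j),
      Category.assoc]
  | _, .snoc k a => by
    have ih := tensorFamAppend_unshuffle X Y j k
    have h := tensor_associativity (tensorFam X j) (tensorFam Y j) (tensorFam X k)
      (tensorFam Y k) (X a) (Y a)
    dsimp only [tensorFamAppend, unshuffle, tensorFam, Arities.append]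
    rw [← tensorHom_comp_tensorHom, ← cancel_epi (α_ _ _ _).hom]
    simp only [Category.assoc, Iso.hom_inv_id_assoc]
    rw [← comp_whiskerRight_assoc, ih]
    simp only [comp_whiskerRight, Category.assoc]
    rw [tensorμ_natural_left]
    rw [← tensorHom_comp_whiskerLeft_assoc]
    rw [← tensorHom_id (unshuffle X Y k), ← associator_naturality_assoc, ← reassoc_of% h]
    simp

/-- The map `(X j₁ ⊗ A^(j₁)) ⊗ ⋯ ⊗ (X j_m ⊗ A^(j_m)) ⟶ (X j₁ ⊗ ⋯ ⊗ X j_m) ⊗ A^(j₁ + ⋯ + j_m)`. -/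
def regroup (X : ℕ → C) (A : C) {m : ℕ} (j : Arities m) :
    tensorFam (fun n => X n ⊗ tensorPow A n) j ⟶ tensorFam X j ⊗ tensorPow A j.sum :=
  unshuffle X (tensorPow A) j ≫ tensorFam X j ◁ tensorPowFlatten A j

theorem tensorFamAppend_regroup (X : ℕ → C) (A : C) {m n : ℕ} (j : Arities m) (k : Arities n) :
    tensorFamAppend (fun n => X n ⊗ tensorPow A n) j k ≫ regroup X A (j.append k) =
      (regroup X A j ⊗ₘ regroup X A k) ≫ tensorμ _ _ _ _ ≫
        (tensorFamAppend X j k ⊗ₘ (tensorPowAdd A j.sum k.sum ≫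
          castObj (tensorPow A) (Arities.sum_append j k).symm)) := by
  simp only [regroup]
  rw [reassoc_of% tensorFamAppend_unshuffle X (tensorPow A) j k, ← tensorHom_comp_tensorHom_assoc]
  rw [← id_tensorHom, ← id_tensorHom, ← id_tensorHom, tensorμ_natural_assoc]
  rw [id_tensorHom, tensorHom_comp_whiskerLeft, tensorHom_comp_tensorHom,
    tensorFamAppend_flatten, id_tensorHom_id, Category.id_comp]

/-- The map `A ≅ 1 ⊗ A^(1) ⟶ O(1) ⊗ A^(1)` given by the unit of the operad. -/
def insertOne (O : OperadData C) (A : C) : A ⟶ O.obj 1 ⊗ tensorPow A 1 :=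
  (λ_ A).inv ≫ (O.one ⊗ₘ toPowOne A)

/-- The shuffle only moves operad units, which come from the unit object, past powers of `A`, so no
genuine permutation occurs. This is the second half of the section property begun in
`powToFam_toPow`. -/
theorem powToFam_regroup (O : OperadData C) (A : C) : (n : ℕ) →
    powToFam (Z := fun n => O.obj n ⊗ tensorPow A n) (insertOne O A) n ≫
      regroup O.obj A (Arities.ones n) =
    (λ_ _).inv ≫ (O.oneFam n ⊗ₘ castObj (tensorPow A) (Arities.sum_ones n).symm)
  | 0 => by
    change 𝟙 (𝟙_ C) ≫ (λ_ (𝟙_ C)).inv ≫ 𝟙_ C ◁ 𝟙 (𝟙_ C) = (λ_ (𝟙_ C)).inv ≫ (𝟙 (𝟙_ C) ⊗ₘ 𝟙 (𝟙_ C))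
    simp
  | n + 1 => by
    have ih := powToFam_regroup O A n
    have h : ((λ_ (𝟙_ C)).inv ▷ (tensorPow A n ⊗ A)) = (λ_ (tensorPow A n ⊗ A)).hom ≫
        ((λ_ (tensorPow A n)).inv ⊗ₘ (λ_ A).inv) ≫ tensorμ (𝟙_ C) (tensorPow A n) (𝟙_ C) A := by
      have := leftUnitor_monoidal (tensorPow A n) A
      rw [← cancel_mono ((λ_ (𝟙_ C)).hom ▷ (tensorPow A n ⊗ A) ≫ (λ_ (tensorPow A n ⊗ A)).hom)]
      simp only [Category.assoc, ← this]
      simp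
    -- The cast at `n + 1` is traded for the cast at `n` tensored with `A ≅ A^(1)`, which is the
    -- shape that `regroup` takes at `snoc`.
    refine Eq.trans ?_ (congrArg
      (fun z : tensorPow A n ⊗ A ⟶ tensorPow A ((Arities.ones n).sum + 1) =>
        (λ_ (tensorPow A n ⊗ A)).inv ≫ (((λ_ (𝟙_ C)).inv ≫ (O.oneFam n ⊗ₘ O.one)) ⊗ₘ z))
      (castObj_tensorHom_tensorPowAdd_one A (Arities.sum_ones n).symm))
    change (powToFam (Z := fun n => O.obj n ⊗ tensorPow A n) (insertOne O A) n ⊗ₘ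
        insertOne O A) ≫ (unshuffle O.obj (tensorPow A) (Arities.ones n) ▷ _ ≫
          tensorμ _ _ _ _) ≫ (tensorFam O.obj (Arities.ones n) ⊗ O.obj 1) ◁
            (tensorPowFlatten A (Arities.ones n) ▷ tensorPow A 1 ≫ tensorPowAdd A _ 1) =
      (λ_ (tensorPow A n ⊗ A)).inv ≫ (((λ_ (𝟙_ C)).inv ≫ (O.oneFam n ⊗ₘ O.one)) ⊗ₘ
        ((castObj (tensorPow A) (Arities.sum_ones n).symm ⊗ₘ toPowOne A) ≫
          tensorPowAdd A (Arities.ones n).sum 1))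
    have h' := tensorμ_natural (𝟙 (tensorFam O.obj (Arities.ones n)))
      (tensorPowFlatten A (Arities.ones n)) (𝟙 (O.obj 1)) (𝟙 (tensorPow A 1))
    simp only [tensorHom_id, id_tensorHom, id_whiskerRight] at h'
    rw [← whiskerRight_comp_tensorHom, reassoc_of% h, Iso.inv_hom_id_assoc,
      ← tensorHom_comp_whiskerLeft, ← tensorμ_natural_assoc, tensorHom_comp_tensorHom_assoc, ← ih]
    simp only [regroup, MonoidalCategory.whiskerLeft_comp, Category.assoc]
    rw [← reassoc_of% h', insertOne, tensorHom_comp_whiskerRight_assoc,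
      tensorHom_comp_whiskerRight_assoc, Category.assoc]

end Braided

/-! ### The operad laws involving the last input -/

namespace OperadData

variable {C : Type u} [Category.{v} C] [MonoidalCategory C]

/-- The partial composition `Γ(-; 1, …, 1, -) : O(m+1) ⊗ O(q) ⟶ O(m+q)` in the last input. -/
def compLastOp (O : OperadData C) (m q : ℕ) : O.obj (m + 1) ⊗ O.obj q ⟶ O.obj (m + q) :=
  O.obj (m + 1) ◁ ((λ_ (O.obj q)).inv ≫ O.oneFam m ▷ O.obj q) ≫
    O.comp (Arities.snoc (Arities.ones m) q) ≫
      eqToHom (congrArg (fun k => O.obj (k + q)) (Arities.sum_ones m))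

/-- The associativity and unit laws of an operad which concern the composition in the last input
of an operation. -/
structure LastInputLaws [BraidedCategory C] (O : OperadData C) : Prop where
  one_compLast (n : ℕ) : O.one ▷ O.obj (n + 1) ≫ O.compLast 0 n =
    (λ_ (O.obj (n + 1))).hom ≫ castObj O.obj (congrArg (· + 1) (Nat.zero_add n).symm)
  compLast_one (m : ℕ) : O.obj (m + 1) ◁ O.one ≫ O.compLast m 0 = (ρ_ (O.obj (m + 1))).hom
  compLast_assoc (m n p : ℕ) : O.compLast m n ▷ O.obj (p + 1) ≫ O.compLast (m + n) p =
    (α_ _ _ _).hom ≫ O.obj (m + 1) ◁ O.compLast n p ≫ O.compLast m (n + p) ≫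
      castObj O.obj (congrArg (· + 1) (Nat.add_assoc m n p).symm)
  -- The interchange law that makes the product respect the relations, and the only one of these
  -- laws that contains a shuffle.
  compOne_append {m n : ℕ} (j : Arities m) (k : Arities n) :
    tensorμ _ _ _ _ ≫ (O.compLast m n ⊗ₘ tensorFamAppend O.obj j k) ≫ O.compOne (j.append k) =
      (O.compOne j ⊗ₘ O.compOne k) ≫ O.compLast j.sum k.sum ≫
        castObj O.obj (congrArg (· + 1) (Arities.sum_append j k).symm)
  compOne_ones (m : ℕ) : O.obj (m + 1) ◁ O.oneFam m ≫ O.compOne (Arities.ones m) =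
    (ρ_ (O.obj (m + 1))).hom ≫ castObj O.obj (congrArg (· + 1) (Arities.sum_ones m).symm)

end OperadData

/-! ### Coherence identities for `tensorμ` -/

section Braided

variable {C : Type u} [Category.{v} C] [MonoidalCategory C] [BraidedCategory C]

/-- The one crossing inside this `tensorμ` is with the unit object, hence a composite of unitors. -/
theorem tensorμ_unit_third (X Y Z : C) :
    tensorμ X Y (𝟙_ C) Z =
      (X ⊗ Y) ◁ (λ_ Z).hom ≫ (α_ X Y Z).hom ≫ (ρ_ X).inv ▷ (Y ⊗ Z) := by
  simp only [tensorμ, braiding_tensorUnit_right]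
  monoidal

/-- Both sides cross `Y` past `Z` exactly once; the inserted unit object adds no crossing. In
`act_last` the map `f` is the tuple of operad units in the first inputs. -/
theorem tensorμ_leftUnitor_inv {X Y Z W T V : C} (f : 𝟙_ C ⟶ T) (g : Y ⟶ V) :
    tensorμ X Y Z W ≫ (X ◁ ((λ_ Z).inv ≫ f ▷ Z) ⊗ₘ g ▷ W) =
      (α_ X Y (Z ⊗ W)).hom ≫ X ◁ (((λ_ Y).inv ≫ (f ⊗ₘ g)) ▷ (Z ⊗ W) ≫ tensorμ T V Z W) ≫
        (α_ _ _ _).inv := by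
  have h : tensorμ X Y Z W ≫ (X ◁ (λ_ Z).inv) ▷ (Y ⊗ W) ≫ (α_ _ _ _).hom =
      (α_ X Y (Z ⊗ W)).hom ≫ X ◁ ((λ_ Y).inv ▷ (Z ⊗ W) ≫ tensorμ (𝟙_ C) Y Z W) := by
    simp only [tensorμ]
    monoidal
  have h2 := tensorμ_natural_left f g Z W
  simp only [MonoidalCategory.whiskerLeft_comp] at h
  rw [comp_whiskerRight, Category.assoc, h2]
  simp only [MonoidalCategory.whiskerLeft_comp, Category.assoc]
  rw [← reassoc_of% h, ← whiskerRight_comp_tensorHom, ← id_tensorHom X (_ ⊗ₘ _),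
    ← id_tensorHom X (f ▷ Z), associator_inv_naturality, Iso.hom_inv_id_assoc]

theorem tensorμ_whiskerRight_associator (X Y Z W V : C) :
    tensorμ X Y Z W ▷ V ≫ (α_ _ _ _).hom ≫ (X ⊗ Z) ◁ (α_ Y W V).hom =
      (α_ _ _ _).hom ≫ (X ⊗ Y) ◁ (α_ Z W V).hom ≫ tensorμ X Y Z (W ⊗ V) := by
  simp only [tensorμ]
  monoidal

/-- `associator_monoidal` arranged for the product of two maps of the form `envComp`, each of which
contains an inverse associator. -/
theorem tensorμ_associator_inv {X₁ X₂ X₃ Y₁ Y₂ Y₃ Z U W V : C} (c : X₁ ⊗ Y₁ ⟶ Z)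
    (a : X₂ ⊗ Y₂ ⟶ U) (q : X₃ ⊗ Y₃ ⟶ W) (f : Z ⊗ U ⟶ V) :
    tensorμ X₁ (X₂ ⊗ X₃) Y₁ (Y₂ ⊗ Y₃) ≫ (c ⊗ₘ (tensorμ X₂ X₃ Y₂ Y₃ ≫ (a ⊗ₘ q))) ≫
        (α_ Z U W).inv ≫ f ▷ W =
      ((α_ X₁ X₂ X₃).inv ⊗ₘ (α_ Y₁ Y₂ Y₃).inv) ≫ tensorμ (X₁ ⊗ X₂) X₃ (Y₁ ⊗ Y₂) Y₃ ≫
        ((tensorμ X₁ X₂ Y₁ Y₂ ≫ (c ⊗ₘ a) ≫ f) ⊗ₘ q) := by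
  rw [← whiskerLeft_comp_tensorHom, Category.assoc, associator_inv_naturality_assoc,
    tensorHom_comp_whiskerRight, ← whiskerRight_comp_tensorHom, ← cancel_epi ((α_ X₁ X₂ X₃).hom ⊗ₘ (α_ Y₁ Y₂ Y₃).hom)]
  have h := associator_monoidal X₁ X₂ X₃ Y₁ Y₂ Y₃
  rw [← reassoc_of% h]
  simp only [Iso.hom_inv_id, Iso.hom_inv_id_assoc, tensorHom_comp_tensorHom_assoc,
    id_tensorHom_id, Category.id_comp, whiskerRight_comp_tensorHom]

theorem regroup_snoc (X : ℕ → C) (A : C) {m : ℕ} (j : Arities m) (a : ℕ) :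
    regroup X A (j.snoc a) = regroup X A j ▷ (X a ⊗ tensorPow A a) ≫ tensorμ _ _ _ _ ≫
      (tensorFam X j ⊗ X a) ◁ tensorPowAdd A j.sum a := by
  have h := tensorμ_natural_left (𝟙 (tensorFam X j)) (tensorPowFlatten A j) (X a) (tensorPow A a)
  simp only [id_tensorHom, id_whiskerRight] at h
  simp only [regroup, comp_whiskerRight, Category.assoc]
  rw [reassoc_of% h, ← MonoidalCategory.whiskerLeft_comp]
  exact Category.assoc _ _ _

end Braided

/-! ### Relations, products and actions on the summands -/

namespace OperadAlgebra

variable {M : Type u} [Category.{v} M] [MonoidalCategory M] [SymmetricCategory M]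
  {O : OperadData M} (A : OperadAlgebra O)

theorem insertOne_act : insertOne O A.X ≫ A.act 1 = 𝟙 A.X := by
  have h := A.act_one
  rw [insertOne, MonoidalCategory.tensorHom_def, Category.assoc, Category.assoc,
    Iso.inv_comp_eq, Category.comp_id]
  exact h

theorem act_comp_regroup {m : ℕ} (j : Arities m) :
    O.obj m ◁ tensorFamToPow A.act j ≫ A.act m =
      O.obj m ◁ regroup O.obj A.X j ≫ (α_ _ _ _).inv ≫ O.comp j ▷ _ ≫ A.act j.sum :=
  A.act_comp j

theorem envComp_eq {m : ℕ} (j : Arities m) :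
    A.envComp ⟨m, j⟩ = O.obj (m + 1) ◁ regroup O.obj A.X j ≫ (α_ _ _ _).inv ≫
      O.compOne j ▷ _ := rfl

/-- The map of relations which covers the multiplication of the enveloping algebra. -/
def envRelationMul {m n : ℕ} (j : Arities m) (k : Arities n) :
    A.envRelation ⟨m, j⟩ ⊗ A.envRelation ⟨n, k⟩ ⟶ A.envRelation ⟨m + n, j.append k⟩ :=
  tensorμ _ _ _ _ ≫ (O.compLast m n ⊗ₘ tensorFamAppend (fun n => O.obj n ⊗ tensorPow A.X n) j k)

theorem envRelationMul_act {m n : ℕ} (j : Arities m) (k : Arities n) :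
    A.envRelationMul j k ≫ A.envAct ⟨m + n, j.append k⟩ =
      (A.envAct ⟨m, j⟩ ⊗ₘ A.envAct ⟨n, k⟩) ≫ A.envMulSummand m n := by
  dsimp only [envRelationMul, envAct, envMulSummand, envRelation, envSummand]
  rw [Category.assoc, tensorHom_comp_whiskerLeft, tensorFamAppend_toPow]
  rw [← id_tensorHom, ← id_tensorHom, tensorμ_natural_assoc, tensorHom_comp_tensorHom,
    id_tensorHom_id, Category.id_comp]

/-- Once the shuffles of the two factors are aligned, what remains on the operad factor is exactly
the interchange law `compOne_append`. -/
theorem envRelationMul_comp (hO : O.LastInputLaws) {m n : ℕ} (j : Arities m) (k : Arities n) :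
    A.envRelationMul j k ≫ A.envComp ⟨m + n, j.append k⟩ =
      (A.envComp ⟨m, j⟩ ⊗ₘ A.envComp ⟨n, k⟩) ≫ A.envMulSummand j.sum k.sum ≫
        (castObj O.obj (congrArg (· + 1) (Arities.sum_append j k).symm) ⊗ₘ
          castObj (tensorPow A.X) (Arities.sum_append j k).symm) := by
  have h := tensorFamAppend_regroup O.obj A.X j k
  have h2 := tensorμ_natural (𝟙 (O.obj (m + 1))) (regroup O.obj A.X j) (𝟙 (O.obj (n + 1)))
    (regroup O.obj A.X k)
  have h3 := tensorμ_natural (O.compOne j) (𝟙 (tensorPow A.X j.sum)) (O.compOne k)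
    (𝟙 (tensorPow A.X k.sum))
  rw [envComp_eq, envComp_eq, envComp_eq]
  dsimp only [envRelationMul, envMulSummand, envRelation, envSummand]
  simp only [tensorHom_id, id_tensorHom, id_whiskerRight] at h2 h3
  rw [Category.assoc, tensorHom_comp_whiskerLeft_assoc, h, ← whiskerLeft_comp_tensorHom_assoc,
    ← reassoc_of% h2, tensorμ_associator_inv, hO.compOne_append, ← tensorHom_comp_tensorHom_assoc,
    ← tensorHom_comp_tensorHom_assoc, Category.assoc, reassoc_of% h3, tensorHom_comp_tensorHom,
    ← whiskerRight_comp_tensorHom]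

/-- The map `O(m+1) ⊗ A^(m) ⟶ O(m+1) ⊗ (O(1) ⊗ A^(1))^(m)` given by the unit of the operad. -/
def envRelationUnit (m : ℕ) : A.envSummand m ⟶ A.envRelation ⟨m, Arities.ones m⟩ :=
  O.obj (m + 1) ◁ powToFam (insertOne O A.X) m

/-- With `envRelationUnit_comp` this says that the parallel pair is reflexive, up to the cast along
`1 + ⋯ + 1 = m`. Reflexivity allows a relation in two variables to be specialised to one variable.
-/
theorem envRelationUnit_act (m : ℕ) : A.envRelationUnit m ≫ A.envAct ⟨m, Arities.ones m⟩ = 𝟙 _ := by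
  have h := powToFam_toPow (Z := fun n => O.obj n ⊗ tensorPow A.X n) (insertOne O A.X) A.act
    A.insertOne_act m
  dsimp only [envRelationUnit, envAct, envRelation, envSummand]
  rw [← MonoidalCategory.whiskerLeft_comp, h, MonoidalCategory.whiskerLeft_id]

theorem envRelationUnit_comp (hO : O.LastInputLaws) (m : ℕ) :
    A.envRelationUnit m ≫ A.envComp ⟨m, Arities.ones m⟩ =
      (castObj O.obj (congrArg (· + 1) (Arities.sum_ones m).symm) ⊗ₘ
        castObj (tensorPow A.X) (Arities.sum_ones m).symm) := by
  have h := powToFam_regroup O A.X m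
  rw [envComp_eq]
  dsimp only [envRelationUnit, envRelation, envSummand]
  rw [← MonoidalCategory.whiskerLeft_comp_assoc, h, MonoidalCategory.tensorHom_def',
    MonoidalCategory.whiskerLeft_comp_assoc, MonoidalCategory.whiskerLeft_comp_assoc,
    associator_inv_naturality_middle_assoc, ← comp_whiskerRight, hO.compOne_ones,
    associator_inv_naturality_right_assoc, comp_whiskerRight,
    whisker_exchange_assoc]
  simp only [MonoidalCategory.tensorHom_def, triangle_assoc_comp_left_inv_assoc,
    inv_hom_whiskerRight_assoc]
  rw [whisker_exchange]

section Actions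

theorem castObj_whiskerRight_act {m n : ℕ} (h : m = n) :
    castObj O.obj h ▷ tensorPow A.X n ≫ A.act n =
      O.obj m ◁ castObj (tensorPow A.X) h.symm ≫ A.act m := by
  subst h; simp

/-- Associativity of the action at the tuple `(1, …, 1, q)` with operad units in the first `m`
inputs, where they act trivially. The case `q = n + 1` gives associativity of the module action, and
`q = 0` computes the action on the algebra unit. -/
theorem act_last (m q : ℕ) :
    tensorμ (O.obj (m + 1)) (tensorPow A.X m) (O.obj q) (tensorPow A.X q) ≫
        (O.compLastOp m q ⊗ₘ tensorPowAdd A.X m q) ≫ A.act (m + q) =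
      (α_ _ _ _).hom ≫ O.obj (m + 1) ◁ tensorPow A.X m ◁ A.act q ≫ A.act (m + 1) := by
  have h := A.act_comp_regroup (Arities.snoc (Arities.ones m) q)
  rw [regroup_snoc] at h
  have h1 := powToFam_regroup O A.X m
  have h2 := powToFam_toPow (Z := fun n => O.obj n ⊗ tensorPow A.X n) (insertOne O A.X) A.act
    A.insertOne_act m
  have h4 := A.castObj_whiskerRight_act (congrArg (· + q) (Arities.sum_ones m))
  have h5 := castObj_tensorHom_tensorPowAdd A.X (Arities.sum_ones m).symm (rfl : q = q)
  simp only [castObj_rfl, tensorHom_id] at h5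
  -- Abstracting `c` and `b` fixes their source objects in unfolded form; `tensorPow A.X (m + 1)`
  -- and the tuple at `snoc` agree with these only by definition, which would block rewriting.
  have key : ∀ (c : O.obj (m + 1) ⊗ (tensorFam O.obj (Arities.ones m) ⊗ O.obj q) ⟶
        O.obj ((Arities.ones m).sum + q)) (b : O.obj (m + 1) ⊗ (tensorPow A.X m ⊗ A.X) ⟶ A.X),
      O.obj (m + 1) ◁ (tensorFamToPow A.act (Arities.ones m) ⊗ₘ A.act q) ≫ b =
        O.obj (m + 1) ◁ (regroup O.obj A.X (Arities.ones m) ▷ (O.obj q ⊗ tensorPow A.X q) ≫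
          tensorμ _ _ _ _ ≫ _ ◁ tensorPowAdd A.X _ q) ≫ (α_ _ _ _).inv ≫ c ▷ _ ≫
            A.act ((Arities.ones m).sum + q) →
      tensorμ (O.obj (m + 1)) (tensorPow A.X m) (O.obj q) (tensorPow A.X q) ≫
        ((O.obj (m + 1) ◁ ((λ_ (O.obj q)).inv ≫ O.oneFam m ▷ O.obj q) ≫ c ≫
          castObj O.obj (congrArg (· + q) (Arities.sum_ones m))) ⊗ₘ tensorPowAdd A.X m q) ≫
            A.act (m + q) =
      (α_ _ _ _).hom ≫ O.obj (m + 1) ◁ tensorPow A.X m ◁ A.act q ≫ b := by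
    intro c b h
    have h6 : tensorPow A.X m ◁ A.act q =
        powToFam (Z := fun n => O.obj n ⊗ tensorPow A.X n) (insertOne O A.X) m ▷ _ ≫
          (tensorFamToPow A.act (Arities.ones m) ⊗ₘ A.act q) := by
      rw [whiskerRight_comp_tensorHom, h2, id_tensorHom]
    have h8 : O.obj (m + 1) ◁ tensorPow A.X m ◁ A.act q ≫ b =
        O.obj (m + 1) ◁ (((λ_ _).inv ≫ (O.oneFam m ⊗ₘ
          castObj (tensorPow A.X) (Arities.sum_ones m).symm)) ▷ (O.obj q ⊗ tensorPow A.X q) ≫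
          tensorμ _ _ _ _ ≫ _ ◁ tensorPowAdd A.X _ q) ≫ (α_ _ _ _).inv ≫ c ▷ _ ≫
            A.act ((Arities.ones m).sum + q) := by
      rw [h6, MonoidalCategory.whiskerLeft_comp_assoc, h,
        ← MonoidalCategory.whiskerLeft_comp_assoc, ← comp_whiskerRight_assoc, h1]
    rw [h8]
    have h7 := tensorμ_leftUnitor_inv (X := O.obj (m + 1)) (Z := O.obj q) (W := tensorPow A.X q)
      (O.oneFam m) (castObj (tensorPow A.X) (Arities.sum_ones m).symm)
    rw [← Category.assoc (_ ▷ _), MonoidalCategory.whiskerLeft_comp _ (_ ≫ _) (_ ◁ _),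
      Category.assoc, associator_inv_naturality_right_assoc, ← reassoc_of% h7, ← Category.assoc _ c,
      ← tensorHom_comp_whiskerRight_assoc, h4, tensorHom_comp_whiskerLeft_assoc, ← h5,
      ← tensorHom_comp_tensorHom_assoc]
    rw [MonoidalCategory.tensorHom_def' c, Category.assoc]
  exact key _ _ h

theorem envMulSummand_act (m n : ℕ) :
    A.envMulSummand m n ▷ A.X ≫ (α_ _ _ _).hom ≫ A.act (m + n + 1) =
      (α_ _ _ _).hom ≫ A.envSummand m ◁ ((α_ _ _ _).hom ≫ A.act (n + 1)) ≫
        (α_ _ _ _).hom ≫ A.act (m + 1) := by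
  have key : ∀ (a : O.obj (m + n + 1) ⊗ (tensorPow A.X (m + n) ⊗ A.X) ⟶ A.X)
      (b : O.obj (n + 1) ⊗ (tensorPow A.X n ⊗ A.X) ⟶ A.X)
      (c : O.obj (m + 1) ⊗ (tensorPow A.X m ⊗ A.X) ⟶ A.X),
      tensorμ (O.obj (m + 1)) (tensorPow A.X m) (O.obj (n + 1)) (tensorPow A.X n ⊗ A.X) ≫
        (O.compLast m n ⊗ₘ ((α_ _ _ _).inv ≫ tensorPowAdd A.X m n ▷ A.X)) ≫ a =
          (α_ _ _ _).hom ≫ O.obj (m + 1) ◁ tensorPow A.X m ◁ b ≫ c →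
      (tensorμ (O.obj (m + 1)) (tensorPow A.X m) (O.obj (n + 1)) (tensorPow A.X n) ≫
        (O.compLast m n ⊗ₘ tensorPowAdd A.X m n)) ▷ A.X ≫ (α_ _ _ _).hom ≫ a =
          (α_ _ _ _).hom ≫ (O.obj (m + 1) ⊗ tensorPow A.X m) ◁ ((α_ _ _ _).hom ≫ b) ≫
            (α_ _ _ _).hom ≫ c := by
    intro a b c h
    have h2 := tensorμ_whiskerRight_associator (O.obj (m + 1)) (tensorPow A.X m) (O.obj (n + 1))
      (tensorPow A.X n) A.X
    rw [MonoidalCategory.whiskerLeft_comp_assoc, associator_naturality_right_assoc, ← h,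
      ← reassoc_of% h2, ← whiskerLeft_comp_tensorHom]
    simp only [comp_whiskerRight, Category.assoc, whiskerLeft_hom_inv_assoc]
    rw [← tensorHom_id (_ ⊗ₘ _), associator_naturality_assoc, tensorHom_id]
  exact key _ _ _ (A.act_last m (n + 1))

/-- Associativity of the action at `(j₁, …, j_m, 1)`, with the operad unit acting trivially on the
last element. It makes the action on `A` descend to the coequalizer. -/
theorem envAct_act {m : ℕ} (j : Arities m) :
    A.envAct ⟨m, j⟩ ▷ A.X ≫ (α_ _ _ _).hom ≫ A.act (m + 1) =
      A.envComp ⟨m, j⟩ ▷ A.X ≫ (α_ _ _ _).hom ≫ A.act (j.sum + 1) := by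
  have h := A.act_comp_regroup (Arities.snoc j 1)
  rw [regroup_snoc] at h
  -- Here `p` stands for the concatenation with `A^(1)`, and its hypothesis says that it undoes `A ≅
  -- A^(1)`.
  have key : ∀ (c : O.obj (m + 1) ⊗ (tensorFam O.obj j ⊗ O.obj 1) ⟶ O.obj (j.sum + 1))
      (b : O.obj (m + 1) ⊗ (tensorPow A.X m ⊗ A.X) ⟶ A.X)
      (a : O.obj (j.sum + 1) ⊗ (tensorPow A.X j.sum ⊗ A.X) ⟶ A.X)
      (p : tensorPow A.X j.sum ⊗ tensorPow A.X 1 ⟶ tensorPow A.X j.sum ⊗ A.X),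
      tensorPow A.X j.sum ◁ toPowOne A.X ≫ p = 𝟙 _ →
      O.obj (m + 1) ◁ (tensorFamToPow A.act j ⊗ₘ A.act 1) ≫ b =
        O.obj (m + 1) ◁ (regroup O.obj A.X j ▷ (O.obj 1 ⊗ tensorPow A.X 1) ≫
          tensorμ _ _ _ _ ≫ _ ◁ p) ≫ (α_ _ _ _).inv ≫ c ▷ _ ≫ a →
      (O.obj (m + 1) ◁ tensorFamToPow A.act j) ▷ A.X ≫ (α_ _ _ _).hom ≫ b =
        (O.obj (m + 1) ◁ regroup O.obj A.X j ≫ (α_ _ _ _).inv ≫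
          (O.obj (m + 1) ◁ ((ρ_ (tensorFam O.obj j)).inv ≫ tensorFam O.obj j ◁ O.one) ≫ c) ▷ _) ▷
            A.X ≫ (α_ _ _ _).hom ≫ a := by
    intro c b a p hp h
    have h1 : tensorFamToPow A.act j ▷ A.X = _ ◁ insertOne O A.X ≫
        (tensorFamToPow A.act j ⊗ₘ A.act 1) := by
      rw [whiskerLeft_comp_tensorHom, A.insertOne_act, tensorHom_id]
    have h2 := tensorμ_natural_right (tensorFam O.obj j) (tensorPow A.X j.sum) O.one
      (toPowOne A.X)
    have h3 := tensorμ_unit_third (tensorFam O.obj j) (tensorPow A.X j.sum) A.X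
    rw [associator_naturality_middle_assoc, h1, MonoidalCategory.whiskerLeft_comp_assoc, h,
      ← MonoidalCategory.whiskerLeft_comp_assoc, whisker_exchange_assoc, insertOne,
      MonoidalCategory.whiskerLeft_comp_assoc _ (λ_ A.X).inv, reassoc_of% h2, h3,
      tensorHom_comp_whiskerLeft, hp, tensorHom_id]
    monoidal
  refine key _ _ _ _ ?_ h
  have h4 := castObj_tensorHom_tensorPowAdd_one A.X (rfl : j.sum = j.sum)
  rw [castObj_rfl, id_tensorHom] at h4
  exact h4

end Actions

theorem one_envMulSummand (hO : O.LastInputLaws) (n : ℕ) :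
    (O.one ≫ (ρ_ (O.obj 1)).inv) ▷ A.envSummand n ≫ A.envMulSummand 0 n =
      (λ_ (A.envSummand n)).hom ≫ (castObj O.obj (congrArg (· + 1) (Nat.zero_add n).symm) ⊗ₘ
        castObj (tensorPow A.X) (Nat.zero_add n).symm) := by
  have h : O.one ≫ (ρ_ (O.obj 1)).inv = (λ_ (𝟙_ M)).inv ≫ (O.one ⊗ₘ 𝟙 (𝟙_ M)) := by
    simp [unitors_inv_equal]
  have h2 := tensorμ_natural_left O.one (𝟙 (𝟙_ M)) (O.obj (n + 1)) (tensorPow A.X n)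
  rw [h]
  have key : ∀ (c : O.obj 1 ⊗ O.obj (n + 1) ⟶ O.obj (0 + n + 1))
      (q : 𝟙_ M ⊗ tensorPow A.X n ⟶ tensorPow A.X (0 + n)),
      O.one ▷ O.obj (n + 1) ≫ c =
        (λ_ _).hom ≫ castObj O.obj (congrArg (· + 1) (Nat.zero_add n).symm) →
      q = (λ_ _).hom ≫ castObj (tensorPow A.X) (Nat.zero_add n).symm →
      ((λ_ (𝟙_ M)).inv ≫ (O.one ⊗ₘ 𝟙 (𝟙_ M))) ▷ (O.obj (n + 1) ⊗ tensorPow A.X n) ≫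
        tensorμ (O.obj 1) (𝟙_ M) (O.obj (n + 1)) (tensorPow A.X n) ≫ (c ⊗ₘ q) =
      (λ_ (O.obj (n + 1) ⊗ tensorPow A.X n)).hom ≫
        (castObj O.obj (congrArg (· + 1) (Nat.zero_add n).symm) ⊗ₘ
          castObj (tensorPow A.X) (Nat.zero_add n).symm) := by
    intro c q hc hq
    rw [comp_whiskerRight_assoc, reassoc_of% h2, tensorHom_comp_tensorHom, hc,
      id_whiskerRight, Category.id_comp, hq, ← tensorHom_comp_tensorHom,
      tensor_left_unitality_assoc]
  exact key _ _ (hO.one_compLast n) (tensorPowAdd_zero_left A.X n)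

theorem envMulSummand_one (hO : O.LastInputLaws) (m : ℕ) :
    A.envSummand m ◁ (O.one ≫ (ρ_ (O.obj 1)).inv) ≫ A.envMulSummand m 0 =
      (ρ_ (A.envSummand m)).hom := by
  have h : O.one ≫ (ρ_ (O.obj 1)).inv = (λ_ (𝟙_ M)).inv ≫ (O.one ⊗ₘ 𝟙 (𝟙_ M)) := by
    simp [unitors_inv_equal]
  have h2 := tensorμ_natural_right (O.obj (m + 1)) (tensorPow A.X m) O.one (𝟙 (𝟙_ M))
  rw [h]
  change (O.obj (m + 1) ⊗ tensorPow A.X m) ◁ ((λ_ (𝟙_ M)).inv ≫ (O.one ⊗ₘ 𝟙 (𝟙_ M))) ≫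
    tensorμ (O.obj (m + 1)) (tensorPow A.X m) (O.obj 1) (𝟙_ M) ≫
      (O.compLast m 0 ⊗ₘ (ρ_ (tensorPow A.X m)).hom) =
        (ρ_ (O.obj (m + 1) ⊗ tensorPow A.X m)).hom
  rw [MonoidalCategory.whiskerLeft_comp_assoc, reassoc_of% h2, tensorHom_comp_tensorHom,
    hO.compLast_one, MonoidalCategory.whiskerLeft_id, Category.id_comp, tensor_right_unitality]

theorem envMulSummand_assoc (hO : O.LastInputLaws) (m n p : ℕ) :
    A.envMulSummand m n ▷ A.envSummand p ≫ A.envMulSummand (m + n) p =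
      (α_ _ _ _).hom ≫ A.envSummand m ◁ A.envMulSummand n p ≫ A.envMulSummand m (n + p) ≫
        (castObj O.obj (congrArg (· + 1) (Nat.add_assoc m n p).symm) ⊗ₘ
          castObj (tensorPow A.X) (Nat.add_assoc m n p).symm) := by
  have h := tensorμ_natural_left (O.compLast m n) (tensorPowAdd A.X m n) (O.obj (p + 1))
    (tensorPow A.X p)
  have h2 := tensorμ_natural_right (O.obj (m + 1)) (tensorPow A.X m) (O.compLast n p)
    (tensorPowAdd A.X n p)
  have h3 := tensor_associativity (O.obj (m + 1)) (tensorPow A.X m) (O.obj (n + 1))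
    (tensorPow A.X n) (O.obj (p + 1)) (tensorPow A.X p)
  dsimp only [envMulSummand, envSummand]
  rw [comp_whiskerRight_assoc, reassoc_of% h, tensorHom_comp_tensorHom, hO.compLast_assoc,
    tensorPowAdd_assoc, ← tensorHom_comp_tensorHom, reassoc_of% h3,
    MonoidalCategory.whiskerLeft_comp_assoc, Category.assoc, reassoc_of% h2]
  simp only [tensorHom_comp_tensorHom]

end OperadAlgebra

/-! ### The same identities with the summands kept as folded objects -/

namespace OperadAlgebra

variable {M : Type u} [Category.{v} M] [MonoidalCategory M] [SymmetricCategory M]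
  {O : OperadData M} (A : OperadAlgebra O)

/-- The multiplication on summands. -/
def summandMul (m n : ℕ) : A.envSummand m ⊗ A.envSummand n ⟶ A.envSummand (m + n) :=
  A.envMulSummand m n

/-- The unit on summands. -/
def summandOne : 𝟙_ M ⟶ A.envSummand 0 := O.one ≫ (ρ_ (O.obj 1)).inv

/-- The action of a summand on `A`. -/
def summandSmul (m : ℕ) : A.envSummand m ⊗ A.X ⟶ A.X :=
  (α_ (O.obj (m + 1)) (tensorPow A.X m) A.X).hom ≫ A.act (m + 1)

/-- The first map of the coequalizer, on one summand. -/
def relationAct {m : ℕ} (j : Arities m) : A.envRelation ⟨m, j⟩ ⟶ A.envSummand m := A.envAct ⟨m, j⟩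

/-- The second map of the coequalizer, on one summand. -/
def relationComp {m : ℕ} (j : Arities m) : A.envRelation ⟨m, j⟩ ⟶ A.envSummand j.sum :=
  A.envComp ⟨m, j⟩

theorem castObj_envSummand {m n : ℕ} (h : m = n) : castObj A.envSummand h =
    (castObj O.obj (congrArg (· + 1) h) ⊗ₘ castObj (tensorPow A.X) h) := by
  subst h
  exact (id_tensorHom_id _ _).symm

theorem envRelationMul_relationAct {m n : ℕ} (j : Arities m) (k : Arities n) :
    A.envRelationMul j k ≫ A.relationAct (j.append k) =
      (A.relationAct j ⊗ₘ A.relationAct k) ≫ A.summandMul m n :=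
  A.envRelationMul_act j k

theorem envRelationMul_relationComp (hO : O.LastInputLaws) {m n : ℕ} (j : Arities m)
    (k : Arities n) : A.envRelationMul j k ≫ A.relationComp (j.append k) =
      (A.relationComp j ⊗ₘ A.relationComp k) ≫ A.summandMul j.sum k.sum ≫
        castObj A.envSummand (Arities.sum_append j k).symm := by
  rw [castObj_envSummand]
  exact A.envRelationMul_comp hO j k

theorem envRelationUnit_relationAct (m : ℕ) :
    A.envRelationUnit m ≫ A.relationAct (Arities.ones m) = 𝟙 _ :=
  A.envRelationUnit_act m

theorem envRelationUnit_relationComp (hO : O.LastInputLaws) (m : ℕ) :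
    A.envRelationUnit m ≫ A.relationComp (Arities.ones m) =
      castObj A.envSummand (Arities.sum_ones m).symm := by
  rw [castObj_envSummand]
  exact A.envRelationUnit_comp hO m

theorem summandMul_summandSmul (m n : ℕ) :
    A.summandMul m n ▷ A.X ≫ A.summandSmul (m + n) =
      (α_ _ _ _).hom ≫ A.envSummand m ◁ A.summandSmul n ≫ A.summandSmul m :=
  A.envMulSummand_act m n

theorem relationAct_summandSmul {m : ℕ} (j : Arities m) :
    A.relationAct j ▷ A.X ≫ A.summandSmul m = A.relationComp j ▷ A.X ≫ A.summandSmul j.sum :=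
  A.envAct_act j

theorem summandOne_summandMul (hO : O.LastInputLaws) (n : ℕ) :
    A.summandOne ▷ A.envSummand n ≫ A.summandMul 0 n =
      (λ_ (A.envSummand n)).hom ≫ castObj A.envSummand (Nat.zero_add n).symm := by
  rw [castObj_envSummand]
  exact A.one_envMulSummand hO n

theorem summandMul_summandOne (hO : O.LastInputLaws) (m : ℕ) :
    A.envSummand m ◁ A.summandOne ≫ A.summandMul m 0 = (ρ_ (A.envSummand m)).hom :=
  A.envMulSummand_one hO m

theorem summandMul_assoc (hO : O.LastInputLaws) (m n p : ℕ) :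
    A.summandMul m n ▷ A.envSummand p ≫ A.summandMul (m + n) p =
      (α_ _ _ _).hom ≫ A.envSummand m ◁ A.summandMul n p ≫ A.summandMul m (n + p) ≫
        castObj A.envSummand (Nat.add_assoc m n p).symm := by
  rw [castObj_envSummand]
  exact A.envMulSummand_assoc hO m n p

theorem summandOne_summandSmul : A.summandOne ▷ A.X ≫ A.summandSmul 0 = (λ_ A.X).hom := by
  have h := A.act_one
  have key : ∀ a : O.obj 1 ⊗ (𝟙_ M ⊗ A.X) ⟶ A.X,
      O.one ▷ A.X ≫ O.obj 1 ◁ (λ_ A.X).inv ≫ a = (λ_ A.X).hom →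
      (O.one ≫ (ρ_ (O.obj 1)).inv) ▷ A.X ≫ (α_ _ _ _).hom ≫ a = (λ_ A.X).hom := by
    intro a h
    rw [← h]
    monoidal
  exact key _ h

/-! ### Universal property of `env A`, also after tensoring -/

section Colimits

variable [HasCountableColimits M]

/-- The inclusion of a summand. -/
def summandι (m : ℕ) : A.envSummand m ⟶ A.env := A.envι m

theorem relationAct_summandι {m : ℕ} (j : Arities m) :
    A.relationAct j ≫ A.summandι m = A.relationComp j ≫ A.summandι j.sum := by
  have h := congrArg (fun f => Sigma.ι A.envRelation ⟨m, j⟩ ≫ f) (coequalizer.condition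
    (Sigma.desc fun s => A.envAct s ≫ Sigma.ι A.envSummand s.1)
    (Sigma.desc fun s => A.envComp s ≫ Sigma.ι A.envSummand s.2.sum))
  simp only [Sigma.ι_desc_assoc, Category.assoc] at h
  exact h

theorem castObj_summandι {m n : ℕ} (h : m = n) :
    castObj A.envSummand h ≫ A.summandι n = A.summandι m := by
  subst h; simp

theorem env_hom_ext {Y : M} {f g : A.env ⟶ Y} (h : ∀ m, A.summandι m ≫ f = A.summandι m ≫ g) :
    f = g := by
  refine coequalizer.hom_ext (Sigma.hom_ext _ _ fun m => ?_)
  exact (Category.assoc _ _ _).symm.trans ((h m).trans (Category.assoc _ _ _))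

theorem exists_env_desc {Y : M} (k : ∀ m, A.envSummand m ⟶ Y)
    (hk : ∀ {m : ℕ} (j : Arities m), A.relationAct j ≫ k m = A.relationComp j ≫ k j.sum) :
    ∃ f : A.env ⟶ Y, ∀ m, A.summandι m ≫ f = k m := by
  refine ⟨coequalizer.desc (Sigma.desc k) (Sigma.hom_ext _ _ fun s => ?_), fun m => ?_⟩
  · simp only [Sigma.ι_desc_assoc, Category.assoc, Sigma.ι_desc]
    exact hk s.2
  · refine (Category.assoc _ _ _).trans ?_
    exact (congrArg _ (coequalizer.π_desc _ _)).trans (Sigma.ι_desc _ _)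

variable [MonoidalClosed M]

/-- Closedness makes `T ⊗ -` a left adjoint, so by currying the universal property of `env A`
survives tensoring. The variants with `env A` on the left follow by the symmetry. -/
theorem tensor_env_hom_ext {T Y : M} {f g : T ⊗ A.env ⟶ Y}
    (h : ∀ m, T ◁ A.summandι m ≫ f = T ◁ A.summandι m ≫ g) : f = g := by
  apply MonoidalClosed.curry_injective
  refine A.env_hom_ext fun m => ?_
  rw [← MonoidalClosed.curry_natural_left, ← MonoidalClosed.curry_natural_left, h]

theorem exists_tensor_env_desc {T Y : M} (k : ∀ m, T ⊗ A.envSummand m ⟶ Y)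
    (hk : ∀ {m : ℕ} (j : Arities m),
      T ◁ A.relationAct j ≫ k m = T ◁ A.relationComp j ≫ k j.sum) :
    ∃ f : T ⊗ A.env ⟶ Y, ∀ m, T ◁ A.summandι m ≫ f = k m := by
  obtain ⟨f, hf⟩ := A.exists_env_desc (fun m => MonoidalClosed.curry (k m)) fun j => by
    rw [← MonoidalClosed.curry_natural_left, ← MonoidalClosed.curry_natural_left, hk]
  refine ⟨MonoidalClosed.uncurry f, fun m => ?_⟩
  rw [← MonoidalClosed.uncurry_natural_left, hf, MonoidalClosed.uncurry_curry]

theorem env_tensor_hom_ext {T Y : M} {f g : A.env ⊗ T ⟶ Y}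
    (h : ∀ m, A.summandι m ▷ T ≫ f = A.summandι m ▷ T ≫ g) : f = g := by
  rw [← cancel_epi (β_ T A.env).hom]
  refine A.tensor_env_hom_ext fun m => ?_
  rw [BraidedCategory.braiding_naturality_right_assoc,
    BraidedCategory.braiding_naturality_right_assoc, h]

theorem exists_env_tensor_desc {T Y : M} (k : ∀ m, A.envSummand m ⊗ T ⟶ Y)
    (hk : ∀ {m : ℕ} (j : Arities m),
      A.relationAct j ▷ T ≫ k m = A.relationComp j ▷ T ≫ k j.sum) :
    ∃ f : A.env ⊗ T ⟶ Y, ∀ m, A.summandι m ▷ T ≫ f = k m := by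
  obtain ⟨f, hf⟩ := A.exists_tensor_env_desc (fun m => (β_ T _).hom ≫ k m) fun j => by
    rw [BraidedCategory.braiding_naturality_right_assoc,
      BraidedCategory.braiding_naturality_right_assoc, hk]
  refine ⟨(β_ T A.env).inv ≫ f, fun m => ?_⟩
  rw [BraidedCategory.braiding_inv_naturality_left_assoc, hf, Iso.inv_hom_id_assoc]

theorem env_tensor_env_hom_ext {Y : M} {f g : A.env ⊗ A.env ⟶ Y}
    (h : ∀ m n, (A.summandι m ⊗ₘ A.summandι n) ≫ f = (A.summandι m ⊗ₘ A.summandι n) ≫ g) :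
    f = g := by
  refine A.env_tensor_hom_ext fun m => A.tensor_env_hom_ext fun n => ?_
  simpa only [MonoidalCategory.tensorHom_def', Category.assoc] using h m n

theorem env_tensor_env_tensor_hom_ext {T Y : M} {f g : (A.env ⊗ A.env) ⊗ T ⟶ Y}
    (h : ∀ m n, (A.summandι m ⊗ₘ A.summandι n) ▷ T ≫ f =
      (A.summandι m ⊗ₘ A.summandι n) ▷ T ≫ g) : f = g := by
  rw [← cancel_epi (β_ _ _).hom]
  apply MonoidalClosed.curry_injective
  refine A.env_tensor_env_hom_ext fun m n => ?_
  rw [← MonoidalClosed.curry_natural_left, ← MonoidalClosed.curry_natural_left,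
    BraidedCategory.braiding_naturality_right_assoc,
    BraidedCategory.braiding_naturality_right_assoc, h]

end Colimits

/-! ### Descent of the monoid and module structures -/

section Structure

variable [HasCountableColimits M]

/-- The two relations are replaced by the single relation for the concatenated tuple, which holds in
`env A`. -/
theorem relationAct_tensorHom_summandMul (hO : O.LastInputLaws) {m n : ℕ} (j : Arities m)
    (k : Arities n) :
    (A.relationAct j ⊗ₘ A.relationAct k) ≫ A.summandMul m n ≫ A.summandι (m + n) =
      (A.relationComp j ⊗ₘ A.relationComp k) ≫ A.summandMul j.sum k.sum ≫
        A.summandι (j.sum + k.sum) := by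
  have h1 := A.envRelationMul_relationAct j k
  have h2 := A.envRelationMul_relationComp hO j k
  rw [← reassoc_of% h1, A.relationAct_summandι, reassoc_of% h2, A.castObj_summandι]

theorem castObj_summandMul_summandι {m m' n n' : ℕ} (h : m = m') (h' : n = n') :
    (castObj A.envSummand h ⊗ₘ castObj A.envSummand h') ≫
      A.summandMul m' n' ≫ A.summandι (m' + n') = A.summandMul m n ≫ A.summandι (m + n) := by
  subst h h'; simp

/-- The two-variable relation at `k = (1, …, 1)`, precomposed with the section `envRelationUnit n`:
the second variable is then changed only by a cast, which the inclusions into `env A` absorb. -/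
theorem relationAct_summandMul (hO : O.LastInputLaws) {m : ℕ} (j : Arities m) (n : ℕ) :
    A.relationAct j ▷ A.envSummand n ≫ A.summandMul m n ≫ A.summandι (m + n) =
      A.relationComp j ▷ A.envSummand n ≫ A.summandMul j.sum n ≫ A.summandι (j.sum + n) := by
  have h := congrArg (fun f => _ ◁ A.envRelationUnit n ≫ f)
    (A.relationAct_tensorHom_summandMul hO j (Arities.ones n))
  have h2 := A.castObj_summandMul_summandι (rfl : j.sum = j.sum) (Arities.sum_ones n).symm
  simp only [castObj_rfl, id_tensorHom] at h2
  rw [whiskerLeft_comp_tensorHom_assoc, whiskerLeft_comp_tensorHom_assoc,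
    A.envRelationUnit_relationAct, A.envRelationUnit_relationComp hO, tensorHom_id] at h
  rw [h, MonoidalCategory.tensorHom_def, Category.assoc, h2]

theorem summandMul_relationAct (hO : O.LastInputLaws) (m : ℕ) {n : ℕ} (k : Arities n) :
    A.envSummand m ◁ A.relationAct k ≫ A.summandMul m n ≫ A.summandι (m + n) =
      A.envSummand m ◁ A.relationComp k ≫ A.summandMul m k.sum ≫ A.summandι (m + k.sum) := by
  have h := congrArg (fun f => A.envRelationUnit m ▷ _ ≫ f)
    (A.relationAct_tensorHom_summandMul hO (Arities.ones m) k)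
  have h2 := A.castObj_summandMul_summandι (Arities.sum_ones m).symm (rfl : k.sum = k.sum)
  simp only [castObj_rfl, tensorHom_id] at h2
  rw [whiskerRight_comp_tensorHom_assoc, whiskerRight_comp_tensorHom_assoc,
    A.envRelationUnit_relationAct, A.envRelationUnit_relationComp hO, id_tensorHom] at h
  rw [h, MonoidalCategory.tensorHom_def', Category.assoc, h2]

variable [MonoidalClosed M]

theorem exists_envMul (hO : O.LastInputLaws) : ∃ f : A.env ⊗ A.env ⟶ A.env,
    ∀ m n, (A.summandι m ⊗ₘ A.summandι n) ≫ f = A.summandMul m n ≫ A.summandι (m + n) := by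
  -- The descent is made in the right variable first, over a fixed left summand; the resulting maps
  -- are then descended in the left variable.
  have h1 (m : ℕ) : ∃ f : A.envSummand m ⊗ A.env ⟶ A.env,
      ∀ n, A.envSummand m ◁ A.summandι n ≫ f = A.summandMul m n ≫ A.summandι (m + n) :=
    A.exists_tensor_env_desc _ fun k => A.summandMul_relationAct hO m k
  choose g hg using h1
  obtain ⟨f, hf⟩ := A.exists_env_tensor_desc g fun {m} j => A.tensor_env_hom_ext fun n => by
    rw [whisker_exchange_assoc, whisker_exchange_assoc, hg, hg]
    exact A.relationAct_summandMul hO j n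
  refine ⟨f, fun m n => ?_⟩
  rw [MonoidalCategory.tensorHom_def', Category.assoc, hf]
  exact hg m n

theorem exists_envSmul : ∃ f : A.env ⊗ A.X ⟶ A.X,
    ∀ m, A.summandι m ▷ A.X ≫ f = A.summandSmul m :=
  A.exists_env_tensor_desc A.summandSmul fun j => A.relationAct_summandSmul j

theorem nonempty_envStructure (hO : O.LastInputLaws) : Nonempty A.EnvStructure := by
  obtain ⟨mul, hmul⟩ := A.exists_envMul hO
  obtain ⟨smul, hsmul⟩ := A.exists_envSmul
  have hmul_left (m n : ℕ) : A.envSummand m ◁ A.summandι n ≫ A.summandι m ▷ A.env ≫ mul =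
      A.summandMul m n ≫ A.summandι (m + n) := by
    rw [← hmul, MonoidalCategory.tensorHom_def', Category.assoc]
  have hmul_right (m n : ℕ) : A.summandι m ▷ A.envSummand n ≫ A.env ◁ A.summandι n ≫ mul =
      A.summandMul m n ≫ A.summandι (m + n) := by
    rw [← hmul, MonoidalCategory.tensorHom_def, Category.assoc]
  let mon : MonObj A.env :=
    { one := A.summandOne ≫ A.summandι 0
      mul := mul
      one_mul := by
        refine A.tensor_env_hom_ext fun n => ?_
        rw [comp_whiskerRight_assoc, whisker_exchange_assoc, hmul_left,
          reassoc_of% A.summandOne_summandMul hO n, A.castObj_summandι, leftUnitor_naturality]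
      mul_one := by
        refine A.env_tensor_hom_ext fun n => ?_
        rw [MonoidalCategory.whiskerLeft_comp_assoc, ← whisker_exchange_assoc, hmul_right,
          reassoc_of% A.summandMul_summandOne hO n, rightUnitor_naturality]
        rfl
      mul_assoc := by
        refine A.env_tensor_env_tensor_hom_ext fun m n => A.tensor_env_hom_ext fun p => ?_
        rw [← comp_whiskerRight_assoc, hmul, comp_whiskerRight_assoc, whisker_exchange_assoc,
          hmul_left, reassoc_of% A.summandMul_assoc hO m n p, A.castObj_summandι,
          MonoidalCategory.tensorHom_def', comp_whiskerRight_assoc,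
          associator_naturality_left_assoc, associator_naturality_middle_assoc,
          associator_naturality_right_assoc, ← whisker_exchange_assoc,
          ← MonoidalCategory.whiskerLeft_comp_assoc, ← MonoidalCategory.whiskerLeft_comp_assoc,
          Category.assoc, hmul_left, MonoidalCategory.whiskerLeft_comp_assoc, hmul_left] }
  let mod : ModObj A.env A.X :=
    { smul := smul
      one_smul := by
        change (A.summandOne ≫ A.summandι 0) ▷ A.X ≫ smul = (λ_ A.X).hom
        rw [comp_whiskerRight_assoc, hsmul, A.summandOne_summandSmul]
      mul_smul := by
        change mul ▷ A.X ≫ smul = (α_ _ _ _).hom ≫ A.env ◁ smul ≫ smul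
        refine A.env_tensor_env_tensor_hom_ext fun m n => ?_
        rw [← comp_whiskerRight_assoc, hmul, comp_whiskerRight_assoc, hsmul,
          A.summandMul_summandSmul]
        rw [MonoidalCategory.tensorHom_def, comp_whiskerRight_assoc, 
          associator_naturality_middle_assoc, associator_naturality_left_assoc,
           ← MonoidalCategory.whiskerLeft_comp_assoc, hsmul, ← whisker_exchange_assoc, hsmul] }
  exact ⟨⟨mon, Category.assoc _ _ _, hmul, mod, hsmul⟩⟩

end Structure

end OperadAlgebra

open Functor.LaxMonoidal

/-! ### Images of operads under strong monoidal functors -/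

section Map

theorem map_castObj {C : Type u} [Category.{v} C] {D : Type*} [Category* D] (F : C ⥤ D)
    (X : ℕ → C) {m n : ℕ} (h : m = n) :
    F.map (castObj X h) = castObj (fun n => F.obj (X n)) h := by
  subst h; simp

variable {C : Type u} [Category.{v} C] [MonoidalCategory C] {D : Type*} [Category* D]
  [MonoidalCategory D] (F : C ⥤ D) [F.Monoidal]

/-- Induction on `k`: right unitality of `F` for the empty tuple, associativity of its structure
maps for one more factor. -/
theorem tensorFamAppend_comparison (X : ℕ → C) {m : ℕ} (j : Arities m) :
    {n : ℕ} → (k : Arities n) →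
      tensorFamAppend (fun n => F.obj (X n)) j k ≫ tensorFamComparison F X (j.append k) =
        (tensorFamComparison F X j ⊗ₘ tensorFamComparison F X k) ≫ μ F _ _ ≫
          F.map (tensorFamAppend X j k)
  | _, .nil => by
    dsimp only [tensorFamAppend, tensorFamComparison, tensorFam, Arities.append]
    rw [MonoidalCategory.tensorHom_def, Category.assoc, ← right_unitality,
      rightUnitor_naturality]
  | _, .snoc k a => by
    have ih := tensorFamAppend_comparison X j k
    dsimp only [tensorFamAppend, tensorFamComparison, tensorFam, Arities.append]
    have h : ∀ {A B A' B' Z : D} (f : A ⟶ A') (g : B ⟶ B'), (f ⊗ₘ g) ▷ Z =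
        (α_ _ _ _).hom ≫ (f ⊗ₘ g ▷ Z) ≫ (α_ _ _ _).inv := by
      intros; rw [← tensorHom_id, ← tensorHom_id, associator_conjugation]
    rw [Category.assoc, ← comp_whiskerRight_assoc, ih, F.map_comp,
      ← tensorHom_comp_whiskerLeft_assoc, associativity_inv_assoc]
    simp only [comp_whiskerRight, Category.assoc, μ_natural_left, h, Iso.inv_hom_id_assoc]

theorem whiskerLeft_rightUnitor_inv_μ {X T U V : C} {T' : D} (f : 𝟙_ C ⟶ U) (t : T' ⟶ F.obj T)
    (c : X ⊗ (T ⊗ U) ⟶ V) :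
    F.obj X ◁ ((ρ_ T').inv ≫ T' ◁ (ε F ≫ F.map f)) ≫
        F.obj X ◁ (t ▷ F.obj U ≫ μ F T U) ≫ μ F X (T ⊗ U) ≫ F.map c =
      F.obj X ◁ t ≫ μ F X T ≫ F.map (X ◁ ((ρ_ T).inv ≫ T ◁ f) ≫ c) := by
  rw [F.map_comp, ← μ_natural_right_assoc, F.map_comp, ← right_unitality_inv]
  simp only [← MonoidalCategory.whiskerLeft_comp_assoc, Category.assoc]
  rw [whisker_exchange_assoc, MonoidalCategory.whiskerLeft_comp (F.obj T), Category.assoc,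
    ← μ_natural_right, rightUnitor_inv_naturality_assoc]

/-- Here `o'` and `o` play the tuples of operad units in `D` and in `C`, and `t` the comparison
between them; `map_oneFam` supplies `h`. -/
theorem whiskerLeft_leftUnitor_inv_μ {X T Q V : C} {T' : D} (o' : 𝟙_ D ⟶ T') (o : 𝟙_ C ⟶ T)
    (t : T' ⟶ F.obj T) (h : o' ≫ t = ε F ≫ F.map o) (c : X ⊗ (T ⊗ Q) ⟶ V) :
    F.obj X ◁ ((λ_ (F.obj Q)).inv ≫ o' ▷ F.obj Q) ≫
        F.obj X ◁ (t ▷ F.obj Q ≫ μ F T Q) ≫ μ F X (T ⊗ Q) ≫ F.map c =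
      μ F X Q ≫ F.map (X ◁ ((λ_ Q).inv ≫ o ▷ Q) ≫ c) := by
  rw [F.map_comp, ← μ_natural_right_assoc, F.map_comp, ← left_unitality_inv]
  simp only [← MonoidalCategory.whiskerLeft_comp_assoc, Category.assoc]
  rw [← comp_whiskerRight_assoc, h, comp_whiskerRight_assoc, ← μ_natural_left]

namespace OperadData

variable (O : OperadData C)

theorem map_compOne {m : ℕ} (j : Arities m) : (O.map F).compOne j =
    F.obj (O.obj (m + 1)) ◁ tensorFamComparison F O.obj j ≫ μ F _ _ ≫ F.map (O.compOne j) :=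
  whiskerLeft_rightUnitor_inv_μ F O.one (tensorFamComparison F O.obj j) (O.comp (Arities.snoc j 1))

theorem map_oneFam : (m : ℕ) → (O.map F).oneFam m ≫ tensorFamComparison F O.obj (Arities.ones m) =
    ε F ≫ F.map (O.oneFam m)
  | 0 => by
    dsimp only [oneFam, map, tensorFamComparison, tensorFam, Arities.ones]
    simp
  | m + 1 => by
    have ih := map_oneFam m
    dsimp only [oneFam, map, tensorFamComparison, tensorFam, Arities.ones] at ih ⊢
    rw [Category.assoc, tensorHom_comp_whiskerRight_assoc, ih, F.map_comp, ← left_unitality_inv,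
      ← tensorHom_comp_tensorHom_assoc]
    simp [MonoidalCategory.tensorHom_def']

theorem map_compLastOp (m q : ℕ) :
    (O.map F).compLastOp m q = μ F _ _ ≫ F.map (O.compLastOp m q) := by
  -- The equality of arities is generalised to `r = s` so that it can be eliminated.
  have key : ∀ {X Q T : C} {T' : D} (o' : 𝟙_ D ⟶ T') (o : 𝟙_ C ⟶ T) (t : T' ⟶ F.obj T)
      {r s : ℕ} (e : r = s) (c : X ⊗ (T ⊗ Q) ⟶ O.obj r), o' ≫ t = ε F ≫ F.map o →
      F.obj X ◁ ((λ_ (F.obj Q)).inv ≫ o' ▷ F.obj Q) ≫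
        (F.obj X ◁ (t ▷ F.obj Q ≫ μ F T Q) ≫ μ F X (T ⊗ Q) ≫ F.map c) ≫
          castObj (fun n => F.obj (O.obj n)) e =
      μ F X Q ≫ F.map (X ◁ ((λ_ Q).inv ≫ o ▷ Q) ≫ c ≫ castObj O.obj e) := by
    intro X Q T T' o' o t r s e c h
    subst e
    simpa using whiskerLeft_leftUnitor_inv_μ F o' o t h c
  exact key _ _ _ (congrArg (· + q) (Arities.sum_ones m))
    (O.comp (Arities.snoc (Arities.ones m) q)) (O.map_oneFam F m)

theorem map_compLast (m n : ℕ) : (O.map F).compLast m n = μ F _ _ ≫ F.map (O.compLast m n) :=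
  O.map_compLastOp F m (n + 1)

end OperadData

end Map

/-- A braided functor carries shuffles to shuffles. This is what the interchange law needs in order
to pass through `F`. -/
theorem tensorμ_comparison {C : Type u} [Category.{v} C] [MonoidalCategory C]
    [BraidedCategory C] {D : Type*} [Category* D] [MonoidalCategory D] [BraidedCategory D]
    (F : C ⥤ D) [F.Braided] {X Y T U W Z : C} {S S' : D} (s : S ⟶ F.obj T) (t : S' ⟶ F.obj U)
    (f : X ⊗ Y ⟶ W) (g : T ⊗ U ⟶ Z) :
    tensorμ (F.obj X) S (F.obj Y) S' ≫
        ((μ F X Y ≫ F.map f) ⊗ₘ ((s ⊗ₘ t) ≫ μ F T U ≫ F.map g)) ≫ μ F W Z =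
      (F.obj X ◁ s ⊗ₘ F.obj Y ◁ t) ≫ (μ F X T ⊗ₘ μ F Y U) ≫ μ F _ _ ≫
        F.map (tensorμ X T Y U) ≫ F.map (f ⊗ₘ g) := by
  have h := tensorμ_natural (𝟙 (F.obj X)) s (𝟙 (F.obj Y)) t
  simp only [id_tensorHom, MonoidalCategory.whiskerLeft_id] at h
  have h2 : (μ F X Y ≫ F.map f) ⊗ₘ ((s ⊗ₘ t) ≫ μ F T U ≫ F.map g) =
      (F.obj X ⊗ F.obj Y) ◁ (s ⊗ₘ t) ≫ (μ F X Y ⊗ₘ μ F T U) ≫ (F.map f ⊗ₘ F.map g) := by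
    rw [tensorHom_comp_tensorHom, whiskerLeft_comp_tensorHom]
  rw [h2, Category.assoc, Category.assoc, ← reassoc_of% h, μ_natural,
    reassoc_of% tensorμ_comp_μ_tensorHom_μ_comp_μ F]

theorem OperadData.LastInputLaws.map {C : Type u} [Category.{v} C] [MonoidalCategory C]
    [BraidedCategory C] {D : Type*} [Category* D] [MonoidalCategory D] [BraidedCategory D]
    {O : OperadData C} (hO : O.LastInputLaws) (F : C ⥤ D) [F.Braided] :
    (O.map F).LastInputLaws where
  one_compLast n := by
    have h := congrArg (fun f => F.map f) (hO.one_compLast n)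
    rw [O.map_compLast F]
    dsimp only [OperadData.map] at h ⊢
    rw [F.map_comp, F.map_comp, map_castObj] at h
    rw [comp_whiskerRight_assoc, μ_natural_left_assoc, h, left_unitality_assoc]
  compLast_one m := by
    have h := congrArg (fun f => F.map f) (hO.compLast_one m)
    rw [O.map_compLast F]
    dsimp only [OperadData.map] at h ⊢
    rw [F.map_comp] at h
    rw [MonoidalCategory.whiskerLeft_comp_assoc, μ_natural_right_assoc, h, right_unitality]
  compLast_assoc m n p := by
    have h := congrArg (fun f => F.map f) (hO.compLast_assoc m n p)
    rw [O.map_compLast F, O.map_compLast F, O.map_compLast F, O.map_compLast F]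
    dsimp only [OperadData.map] at h ⊢
    simp only [F.map_comp, map_castObj] at h
    rw [comp_whiskerRight_assoc, μ_natural_left_assoc, h, associativity_assoc]
    simp
  compOne_append j k := by
    have h := congrArg (fun f => F.map f) (hO.compOne_append j k)
    rw [O.map_compLast F, O.map_compLast F, O.map_compOne F, O.map_compOne F, O.map_compOne F]
    dsimp only [OperadData.map] at h ⊢
    simp only [F.map_comp, map_castObj] at h
    rw [tensorHom_comp_whiskerLeft_assoc, tensorFamAppend_comparison]
    rw [reassoc_of% tensorμ_comparison F, h]
    simp only [← MonoidalCategory.tensorHom_comp_tensorHom_assoc, Category.assoc, μ_natural_assoc]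
  compOne_ones m := by
    have h := congrArg (fun f => F.map f) (hO.compOne_ones m)
    have h2 := O.map_oneFam F m
    rw [O.map_compOne F]
    dsimp only [OperadData.map] at h h2 ⊢
    simp only [F.map_comp, map_castObj] at h
    rw [← MonoidalCategory.whiskerLeft_comp_assoc, h2, MonoidalCategory.whiskerLeft_comp_assoc,
      μ_natural_right_assoc, h, right_unitality_assoc]

/-! ### Points of spaces; points of products seen only through the two projections -/

section Points

variable {P : ObjectProperty TopCat.{w}}

/-- The value of a map of spaces at a point. -/
def value {X Y : P.FullSubcategory} (f : X ⟶ Y) (x : X.obj) : Y.obj := f.hom x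

theorem value_ext {X Y : P.FullSubcategory} {f g : X ⟶ Y} (h : ∀ x, value f x = value g x) :
    f = g :=
  ObjectProperty.hom_ext _ (TopCat.ext h)

@[simp] theorem value_id {X : P.FullSubcategory} (x : X.obj) : value (𝟙 X) x = x := rfl

@[simp] theorem value_comp {X Y Z : P.FullSubcategory} (f : X ⟶ Y) (g : Y ⟶ Z) (x : X.obj) :
    value (f ≫ g) x = value g (value f x) := rfl

@[simp] theorem value_constMap {X Y : P.FullSubcategory} (y : Y.obj) (x : X.obj) :
    value (constMap y : X ⟶ Y) x = y := rfl

variable [CartesianMonoidalCategory P.FullSubcategory]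

/-- The first coordinate of a point of a product. -/
def left {X Y : P.FullSubcategory} (p : (X ⊗ Y).obj) : X.obj := value (fst X Y) p

/-- The second coordinate of a point of a product. -/
def right {X Y : P.FullSubcategory} (p : (X ⊗ Y).obj) : Y.obj := value (snd X Y) p

section

variable {X Y Z W X' Y' : P.FullSubcategory}

theorem left_value (f : Z ⟶ X ⊗ Y) (z : Z.obj) : left (value f z) = value (f ≫ fst X Y) z := rfl

theorem right_value (f : Z ⟶ X ⊗ Y) (z : Z.obj) : right (value f z) = value (f ≫ snd X Y) z := rfl

@[simp] theorem value_fst (p : (X ⊗ Y).obj) : value (fst X Y) p = left p := rfl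

@[simp] theorem value_snd (p : (X ⊗ Y).obj) : value (snd X Y) p = right p := rfl

@[simp] theorem left_tensorHom (f : X ⟶ X') (g : Y ⟶ Y') (p : (X ⊗ Y).obj) :
    left (value (f ⊗ₘ g) p) = value f (left p) := by simp [left_value]

@[simp] theorem right_tensorHom (f : X ⟶ X') (g : Y ⟶ Y') (p : (X ⊗ Y).obj) :
    right (value (f ⊗ₘ g) p) = value g (right p) := by simp [right_value]

@[simp] theorem left_whiskerLeft (g : Y ⟶ Y') (p : (X ⊗ Y).obj) :
    left (value (X ◁ g) p) = left p := by simp [left_value]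

@[simp] theorem right_whiskerLeft (g : Y ⟶ Y') (p : (X ⊗ Y).obj) :
    right (value (X ◁ g) p) = value g (right p) := by simp [right_value]

@[simp] theorem left_whiskerRight (f : X ⟶ X') (p : (X ⊗ Y).obj) :
    left (value (f ▷ Y) p) = value f (left p) := by simp [left_value]

@[simp] theorem right_whiskerRight (f : X ⟶ X') (p : (X ⊗ Y).obj) :
    right (value (f ▷ Y) p) = right p := by simp [right_value]

@[simp] theorem left_associator_hom (p : ((X ⊗ Y) ⊗ Z).obj) :
    left (value (α_ X Y Z).hom p) = left (left p) := by simp [left_value]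

@[simp] theorem left_right_associator_hom (p : ((X ⊗ Y) ⊗ Z).obj) :
    left (right (value (α_ X Y Z).hom p)) = right (left p) := by
  rw [right_value, left_value]; simp

@[simp] theorem right_right_associator_hom (p : ((X ⊗ Y) ⊗ Z).obj) :
    right (right (value (α_ X Y Z).hom p)) = right p := by
  rw [right_value, right_value]; simp

@[simp] theorem left_left_associator_inv (p : (X ⊗ (Y ⊗ Z)).obj) :
    left (left (value (α_ X Y Z).inv p)) = left p := by
  rw [left_value, left_value]; simp

@[simp] theorem right_left_associator_inv (p : (X ⊗ (Y ⊗ Z)).obj) :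
    right (left (value (α_ X Y Z).inv p)) = left (right p) := by
  rw [left_value, right_value]; simp

@[simp] theorem right_associator_inv (p : (X ⊗ (Y ⊗ Z)).obj) :
    right (value (α_ X Y Z).inv p) = right (right p) := by
  rw [right_value]; simp

@[simp] theorem value_rightUnitor_hom (p : (X ⊗ 𝟙_ P.FullSubcategory).obj) :
    value (ρ_ X).hom p = left p := by
  rw [rightUnitor_hom, value_fst]

@[simp] theorem value_leftUnitor_hom (p : (𝟙_ P.FullSubcategory ⊗ X).obj) :
    value (λ_ X).hom p = right p := by
  rw [leftUnitor_hom, value_snd]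

@[simp] theorem left_rightUnitor_inv (x : X.obj) : left (value (ρ_ X).inv x) = x := by
  simp [left_value]

@[simp] theorem right_leftUnitor_inv (x : X.obj) : right (value (λ_ X).inv x) = x := by
  simp [right_value]

@[simp] theorem left_tensorμ [BraidedCategory P.FullSubcategory] (p : ((X ⊗ Y) ⊗ (Z ⊗ W)).obj) :
    left (value (tensorμ X Y Z W) p) = value (fst X Y ⊗ₘ fst Z W) p := by
  rw [left_value, tensorμ_fst]

@[simp] theorem right_tensorμ [BraidedCategory P.FullSubcategory] (p : ((X ⊗ Y) ⊗ (Z ⊗ W)).obj) :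
    right (value (tensorμ X Y Z W) p) = value (snd X Y ⊗ₘ snd Z W) p := by
  rw [right_value, tensorμ_snd]

end

end Points

/-! ### Composition of little intervals as substitution in lists -/

/-- The list obtained by composing the intervals in the `i`-th entry of `d` with the `i`-th
interval of `c`. -/
def composeList (c : List (ℝ × ℝ)) (d : List (List (ℝ × ℝ))) : List (ℝ × ℝ) :=
  (List.zipWith (fun p => List.map (rescale p)) c d).flatten

theorem rescale_zero_one (p : ℝ × ℝ) : rescale p (0, 1) = p := by
  simp [rescale]

theorem zero_one_rescale (p : ℝ × ℝ) : rescale (0, 1) p = p := by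
  simp [rescale]

theorem rescale_rescale (p q r : ℝ × ℝ) :
    rescale (rescale p q) r = rescale p (rescale q r) := by
  simp only [rescale, Prod.mk.injEq]
  constructor <;> ring

theorem rescale_comp_rescale (p q : ℝ × ℝ) :
    rescale p ∘ rescale q = rescale (rescale p q) :=
  funext fun r => (rescale_rescale p q r).symm

theorem composeList_append {c c' : List (ℝ × ℝ)} {d d' : List (List (ℝ × ℝ))}
    (h : c.length = d.length) :
    composeList (c ++ c') (d ++ d') = composeList c d ++ composeList c' d' := by
  rw [composeList, List.zipWith_append h, List.flatten_append]
  rfl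

theorem composeList_singleton (p : ℝ × ℝ) (y : List (ℝ × ℝ)) :
    composeList [p] [y] = y.map (rescale p) := by
  simp [composeList]

/-- Rescaling by `p` is composition with `p` on the outside, so this is associativity of composition
of affine maps. Both the interchange law and the compatibility of the contraction with the relations
rest on it. -/
theorem composeList_map_rescale (p : ℝ × ℝ) (c : List (ℝ × ℝ)) (d : List (List (ℝ × ℝ))) :
    composeList (c.map (rescale p)) d = (composeList c d).map (rescale p) := by
  induction c generalizing d with
  | nil => simp [composeList]
  | cons q c ih =>
    cases d with
    | nil => simp [composeList]
    | cons y d =>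
      have := ih d
      simp only [composeList] at this
      simp [composeList, this, rescale_comp_rescale]

theorem composeList_replicate (c : List (ℝ × ℝ)) :
    composeList c (List.replicate c.length [(0, 1)]) = c := by
  induction c with
  | nil => rfl
  | cons p c ih =>
    simp only [composeList] at ih
    simp [composeList, List.replicate_succ, ih, rescale_zero_one]

section Lists

variable {P : ObjectProperty TopCat.{w}} [ContainsConvexSets P]

/-- The list of intervals given by a point of the space of little intervals. -/
def toList {m : ℕ} (c : (intervals P m).obj) : List (ℝ × ℝ) := List.ofFn (endpoints c)

@[simp] theorem length_toList {m : ℕ} (c : (intervals P m).obj) : (toList c).length = m :=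
  List.length_ofFn

theorem endpoints_injective {m : ℕ} {c d : (intervals P m).obj} (h : endpoints c = endpoints d) :
    c = d :=
  ULift.down_injective (Subtype.ext h)

theorem toList_injective {m : ℕ} {c d : (intervals P m).obj} (h : toList c = toList d) : c = d :=
  endpoints_injective (List.ofFn_injective h)

/-- Operad identities become identities of lists, on which casts between arities are invisible.
Equality is tested only in spaces of intervals, so it never matters whether the two projections
determine a point of a product. -/
theorem intervals_hom_ext {X : P.FullSubcategory} {m : ℕ} {f g : X ⟶ intervals P m}
    (h : ∀ x, toList (value f x) = toList (value g x)) : f = g :=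
  value_ext fun x => toList_injective (h x)

@[simp] theorem toList_castObj {m n : ℕ} (h : m = n) (c : (intervals P m).obj) :
    toList (value (castObj (intervals P) h) c) = toList c := by
  subst h; rfl

theorem exists_toList_eq_concat {m : ℕ} (c : (intervals P (m + 1)).obj) :
    ∃ (c' : List (ℝ × ℝ)) (p : ℝ × ℝ), c'.length = m ∧ toList c = c' ++ [p] :=
  ⟨List.ofFn fun i : Fin m => endpoints c i.castSucc, endpoints c (Fin.last m), by simp, by
    rw [toList, List.ofFn_succ_last]⟩

variable [CartesianMonoidalCategory P.FullSubcategory]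

/-- The list of lists of intervals given by a tuple of points of spaces of little intervals. -/
def famToList : {m : ℕ} → (j : Arities m) → (tensorFam (intervals P) j).obj →
    List (List (ℝ × ℝ))
  | _, .nil, _ => []
  | _, .snoc j a, d => famToList j (left (Y := intervals P a) d) ++
      [toList (right (X := tensorFam (intervals P) j) (Y := intervals P a) d)]

@[simp] theorem length_famToList : {m : ℕ} → (j : Arities m) →
    (d : (tensorFam (intervals P) j).obj) → (famToList j d).length = m
  | _, .nil, _ => rfl
  | _, .snoc j a, d => by simp [famToList, length_famToList j]

theorem ofFn_composeFun : {m : ℕ} → (j : Arities m) → (c : Fin m → ℝ × ℝ) →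
    (d : (tensorFam (intervals P) j).obj) →
    List.ofFn (composeFun P j c d) = composeList (List.ofFn c) (famToList j d)
  | _, .nil, _, _ => by
    simp only [Arities.sum, List.ofFn_zero]
    rfl
  | m + 1, .snoc j a, c, d => by
    rw [List.ofFn_succ_last, famToList, composeList_append (by simp), composeList_singleton,
      ← ofFn_composeFun j]
    refine (List.ofFn_fin_append _ _).trans (congrArg₂ _ rfl ?_)
    simp only [toList, List.map_ofFn]
    rfl

theorem toList_comp {m : ℕ} (j : Arities m) (p : (intervals P m ⊗ tensorFam (intervals P) j).obj) :
    toList (value ((littleIntervals P).comp j) p) =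
      composeList (toList (left p)) (famToList j (right p)) :=
  ofFn_composeFun j _ _

variable (P) in
/-- The unit of the operad of little intervals. -/
def unitPoint : 𝟙_ P.FullSubcategory ⟶ intervals P 1 := (littleIntervals P).one

variable (P) in
/-- The tuple of units of the operad of little intervals. -/
def unitPoints (m : ℕ) : 𝟙_ P.FullSubcategory ⟶ tensorFam (intervals P) (Arities.ones m) :=
  (littleIntervals P).oneFam m

/-- The composition of little intervals with the unit in the last input. -/
def composeOne {m : ℕ} (j : Arities m) :
    intervals P (m + 1) ⊗ tensorFam (intervals P) j ⟶ intervals P (j.sum + 1) :=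
  (littleIntervals P).compOne j

variable (P) in
/-- The composition of little intervals in the last input. -/
def composeLast (m q : ℕ) : intervals P (m + 1) ⊗ intervals P q ⟶ intervals P (m + q) :=
  (littleIntervals P).compLastOp m q

theorem toList_unitPoint (p : (𝟙_ P.FullSubcategory).obj) :
    toList (value (unitPoint P) p) = [(0, 1)] := by
  simp [toList]
  rfl

theorem toList_composeOne {m : ℕ} (j : Arities m)
    (p : (intervals P (m + 1) ⊗ tensorFam (intervals P) j).obj) :
    toList (value (composeOne j) p) =
      composeList (toList (left p)) (famToList j (right p) ++ [[(0, 1)]]) := by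
  -- The point `t` of the terminal object at which the unit is evaluated is left unspecified,
  -- because the unit map is constant.
  have key : ∀ {X T S : P.FullSubcategory} (o : 𝟙_ P.FullSubcategory ⟶ S) (p : (X ⊗ T).obj),
      left (value (X ◁ ((ρ_ T).inv ≫ T ◁ o)) p) = left p ∧
        left (right (value (X ◁ ((ρ_ T).inv ≫ T ◁ o)) p)) = right p ∧
        ∃ t, right (right (value (X ◁ ((ρ_ T).inv ≫ T ◁ o)) p)) = value o t := fun o p =>
    ⟨by simp, by simp, _, by rw [right_whiskerLeft, value_comp, right_whiskerLeft]⟩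
  obtain ⟨h1, h2, t, h3⟩ := key (unitPoint P) p
  refine (toList_comp (Arities.snoc j 1) _).trans ?_
  refine congrArg₂ composeList (congrArg toList h1) (congrArg₂ _ (congrArg (famToList j) h2) ?_)
  exact congrArg (fun l => [l]) ((congrArg toList h3).trans (toList_unitPoint t))

theorem famToList_unitPoints : (m : ℕ) → (p : (𝟙_ P.FullSubcategory).obj) →
    famToList (Arities.ones m) (value (unitPoints P m) p) =
      List.replicate m [(0, 1)]
  | 0, _ => rfl
  | m + 1, p => by
    have key : ∀ {S T : P.FullSubcategory} (f : 𝟙_ P.FullSubcategory ⟶ S)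
        (g : 𝟙_ P.FullSubcategory ⟶ T), ∃ t t',
        left (value ((λ_ (𝟙_ P.FullSubcategory)).inv ≫ (f ⊗ₘ g)) p) = value f t ∧
        right (value ((λ_ (𝟙_ P.FullSubcategory)).inv ≫ (f ⊗ₘ g)) p) = value g t' :=
      fun f g => ⟨_, _, by rw [value_comp, left_tensorHom], by rw [value_comp, right_tensorHom]⟩
    obtain ⟨t, t', h, h'⟩ := key (unitPoints P m) (unitPoint P)
    rw [List.replicate_succ']
    refine congrArg₂ (· ++ [·]) ((congrArg (famToList (Arities.ones m)) h).trans
      (famToList_unitPoints m t)) ((congrArg toList h').trans (toList_unitPoint t'))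

theorem toList_composeLast (m q : ℕ) (p : (intervals P (m + 1) ⊗ intervals P q).obj) :
    toList (value (composeLast P m q) p) =
      composeList (toList (left p)) (List.replicate m [(0, 1)] ++ [toList (right p)]) := by
  have key : ∀ {X T Q : P.FullSubcategory} (o : 𝟙_ P.FullSubcategory ⟶ T) (p : (X ⊗ Q).obj),
      left (value (X ◁ ((λ_ Q).inv ≫ o ▷ Q)) p) = left p ∧
        right (right (value (X ◁ ((λ_ Q).inv ≫ o ▷ Q)) p)) = right p ∧
        ∃ t, left (right (value (X ◁ ((λ_ Q).inv ≫ o ▷ Q)) p)) = value o t := fun o p =>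
    ⟨by simp, by simp, _, by rw [right_whiskerLeft, value_comp, left_whiskerRight]⟩
  obtain ⟨h1, h2, t, h3⟩ := key (unitPoints P m) p
  refine (toList_castObj (congrArg (· + q) (Arities.sum_ones m)) _).trans ?_
  refine (toList_comp (Arities.snoc (Arities.ones m) q) _).trans ?_
  refine congrArg₂ composeList (congrArg toList h1) (congrArg₂ (· ++ [·]) ?_ (congrArg toList h2))
  exact (congrArg (famToList (Arities.ones m)) h3).trans (famToList_unitPoints m t)

/-- Composition in the last input replaces the last interval. -/
theorem toList_composeLast_of_eq {m q : ℕ} {p : (intervals P (m + 1) ⊗ intervals P q).obj}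
    {c : List (ℝ × ℝ)} {r : ℝ × ℝ} (hc : c.length = m) (h : toList (left p) = c ++ [r]) :
    toList (value (composeLast P m q) p) =
      c ++ (toList (right p)).map (rescale r) := by
  subst hc
  rw [toList_composeLast, h, composeList_append (by simp), composeList_replicate,
    composeList_singleton]

/-- The last interval `r` receives the operad unit, and rescaling `(0, 1)` by `r` returns `r`. -/
theorem toList_composeOne_of_eq {m : ℕ} {j : Arities m}
    {p : (intervals P (m + 1) ⊗ tensorFam (intervals P) j).obj}
    {c : List (ℝ × ℝ)} {r : ℝ × ℝ} (hc : c.length = m) (h : toList (left p) = c ++ [r]) :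
    toList (value (composeOne j) p) =
      composeList c (famToList j (right p)) ++ [r] := by
  rw [toList_composeOne, h, composeList_append (by simp [hc]), composeList_singleton,
    List.map_singleton, rescale_zero_one]

theorem famToList_append {m : ℕ} (j : Arities m) : {n : ℕ} → (k : Arities n) →
    (p : (tensorFam (intervals P) j ⊗ tensorFam (intervals P) k).obj) →
    famToList (j.append k) (value (tensorFamAppend (intervals P) j k) p) =
      famToList j (left p) ++ famToList k (right p)
  | _, .nil, p =>
    (congrArg (famToList j) (value_rightUnitor_hom p)).trans (List.append_nil _).symm
  | _, .snoc k a, p => by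
    have key : ∀ {X Y Z W : P.FullSubcategory} (f : X ⊗ Y ⟶ W) (p : (X ⊗ (Y ⊗ Z)).obj), ∃ q,
        left (value ((α_ X Y Z).inv ≫ f ▷ Z) p) = value f q ∧ left q = left p ∧
        right q = left (right p) ∧
        right (value ((α_ X Y Z).inv ≫ f ▷ Z) p) = right (right p) := fun f p =>
      ⟨_, by rw [value_comp, left_whiskerRight], by simp, by simp, by simp⟩
    obtain ⟨q, h1, h2, h3, h4⟩ := key (tensorFamAppend (intervals P) j k) p
    refine (congrArg₂ (fun x y => x ++ [toList y])
      ((congrArg (famToList (j.append k)) h1).trans (famToList_append j k q)) h4).trans ?_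
    rw [h2, h3]
    exact List.append_assoc _ _ _

theorem toList_one_composeLast (n : ℕ) (x : (𝟙_ P.FullSubcategory ⊗ intervals P (n + 1)).obj) :
    toList (value (composeLast P 0 (n + 1))
      (value (unitPoint P ▷ intervals P (n + 1)) x)) = toList (right x) := by
  rw [toList_composeLast_of_eq (m := 0) (c := []) (r := (0, 1)) rfl,
    right_whiskerRight, funext zero_one_rescale, List.map_id', List.nil_append]
  rw [left_whiskerRight]
  exact toList_unitPoint _

theorem toList_composeLast_one (m : ℕ) (x : (intervals P (m + 1) ⊗ 𝟙_ P.FullSubcategory).obj) :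
    toList (value (composeLast P m 1)
      (value (intervals P (m + 1) ◁ unitPoint P) x)) = toList (left x) := by
  obtain ⟨c, r, hc, h⟩ := exists_toList_eq_concat (left x)
  rw [toList_composeLast_of_eq (c := c) (r := r) hc, right_whiskerLeft, toList_unitPoint, h,
    List.map_singleton, rescale_zero_one]
  rw [left_whiskerLeft, h]

/-- For operations `c ++ [r]`, `d ++ [s]` and `e`, both sides are `c`, then `d` rescaled by `r`,
then `e` rescaled by `rescale r s`. -/
theorem toList_composeLast_assoc (m n p : ℕ)
    (x : ((intervals P (m + 1) ⊗ intervals P (n + 1)) ⊗ intervals P (p + 1)).obj) :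
    toList (value (composeLast P (m + n) (p + 1))
      (value (composeLast P m (n + 1) ▷ intervals P (p + 1)) x)) =
    toList (value (composeLast P m (n + p + 1))
      (value (intervals P (m + 1) ◁ composeLast P n (p + 1))
        (value (α_ _ _ _).hom x))) := by
  obtain ⟨c, r, hc, h⟩ := exists_toList_eq_concat (left (left x))
  obtain ⟨d, s, hd, h'⟩ := exists_toList_eq_concat (right (left x))
  rw [toList_composeLast_of_eq (c := c ++ d.map (rescale r)) (r := rescale r s)
    (by simp [hc, hd]), toList_composeLast_of_eq (c := c) (r := r) hc]
  rotate_left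
  · simpa using h
  · rw [left_whiskerRight]
    refine (toList_composeLast_of_eq hc h).trans ?_
    rw [h']
    simp
  · rw [right_whiskerLeft, toList_composeLast_of_eq (c := d) (r := s) hd (by simpa using h')]
    simp [rescale_comp_rescale]

/-- For operations `c ++ [r]` and `d ++ [s]`, both sides are `c` composed with the first family,
then `d` composed with the second family and rescaled by `r`, then `rescale r s`. -/
theorem toList_composeOne_append [BraidedCategory P.FullSubcategory] {m n : ℕ} (j : Arities m)
    (k : Arities n) (x : ((intervals P (m + 1) ⊗ tensorFam (intervals P) j) ⊗
      (intervals P (n + 1) ⊗ tensorFam (intervals P) k)).obj) :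
    toList (value (composeOne (j.append k))
      (value (composeLast P m (n + 1) ⊗ₘ tensorFamAppend (intervals P) j k)
        (value (tensorμ _ _ _ _) x))) =
    toList (value (composeLast P j.sum (k.sum + 1))
      (value (composeOne j ⊗ₘ composeOne k) x)) := by
  obtain ⟨c, r, hc, h⟩ := exists_toList_eq_concat (left (left x))
  obtain ⟨d, s, hd, h'⟩ := exists_toList_eq_concat (left (right x))
  have hj := toList_composeOne_of_eq (p := left x) hc h
  have hl := congrArg List.length hj
  simp only [length_toList, List.length_append, List.length_singleton, Nat.add_right_cancel_iff]
    at hl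
  rw [toList_composeOne_of_eq (c := c ++ d.map (rescale r)) (r := rescale r s)
    (by simp [hc, hd]), toList_composeLast_of_eq
      (c := composeList c (famToList j (right (left x)))) (r := r) hl.symm]
  rotate_left
  · rw [left_tensorHom]
    exact hj
  · rw [left_tensorHom]
    refine (toList_composeLast_of_eq hc (by simpa using h)).trans ?_
    simp [h']
  · rw [right_tensorHom, right_tensorHom, famToList_append, composeList_append (by simp [hc]),
      toList_composeOne_of_eq hd h']
    simp [composeList_map_rescale]

theorem toList_composeOne_ones (m : ℕ) (x : (intervals P (m + 1) ⊗ 𝟙_ P.FullSubcategory).obj) :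
    toList (value (composeOne (Arities.ones m))
      (value (intervals P (m + 1) ◁ unitPoints P m) x)) = toList (left x) := by
  obtain ⟨c, r, hc, h⟩ := exists_toList_eq_concat (left x)
  rw [toList_composeOne_of_eq (c := c) (r := r) hc, right_whiskerLeft, h]
  · refine (congrArg (fun l => composeList c l ++ [r]) (famToList_unitPoints m _)).trans ?_
    rw [← hc, composeList_replicate]
  · rw [left_whiskerLeft, h]

theorem lastInputLaws_littleIntervals [BraidedCategory P.FullSubcategory] :
    (littleIntervals P).LastInputLaws where
  one_compLast n := intervals_hom_ext (X := 𝟙_ P.FullSubcategory ⊗ intervals P (n + 1)) fun x =>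
    (toList_one_composeLast n x).trans ((toList_castObj _ _).trans
      (congrArg toList (value_leftUnitor_hom x))).symm
  compLast_one m := intervals_hom_ext (X := intervals P (m + 1) ⊗ 𝟙_ P.FullSubcategory) fun x =>
    (toList_composeLast_one m x).trans (congrArg toList (value_rightUnitor_hom x)).symm
  compLast_assoc m n p := intervals_hom_ext
    (X := (intervals P (m + 1) ⊗ intervals P (n + 1)) ⊗ intervals P (p + 1)) fun x =>
    (toList_composeLast_assoc m n p x).trans (toList_castObj _ _).symm
  compOne_append {m n} j k := intervals_hom_ext
    (X := (intervals P (m + 1) ⊗ tensorFam (intervals P) j) ⊗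
      (intervals P (n + 1) ⊗ tensorFam (intervals P) k)) fun x =>
    (toList_composeOne_append j k x).trans (toList_castObj _ _).symm
  compOne_ones m := intervals_hom_ext (X := intervals P (m + 1) ⊗ 𝟙_ P.FullSubcategory) fun x =>
    (toList_composeOne_ones m x).trans ((toList_castObj _ _).trans
      (congrArg toList (value_rightUnitor_hom x))).symm

end Lists

/-! ### The straight-line contraction of the spaces of little intervals -/

section Contraction

section

variable {P : ObjectProperty TopCat.{w}} [CartesianMonoidalCategory P.FullSubcategory]

/-- The restriction of a map on a product to a point of the first factor. -/
def restrictAt {X Y Z : P.FullSubcategory} (h : X ⊗ Y ⟶ Z) (t : X.obj) : Y ⟶ Z :=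
  (λ_ Y).inv ≫ constMap t ▷ Y ≫ h

theorem exists_value_restrictAt {X Y Z : P.FullSubcategory} (h : X ⊗ Y ⟶ Z) (t : X.obj)
    (y : Y.obj) : ∃ p, value (restrictAt h t) y = value h p ∧ left p = t ∧ right p = y :=
  ⟨_, by rw [restrictAt, value_comp, value_comp], by simp, by simp⟩

end

/-- Halve all intervals but the last one, and replace the last one by `[1/2, 1]`. -/
def halve {m : ℕ} (x : Fin (m + 1) → ℝ × ℝ) : Fin (m + 1) → ℝ × ℝ :=
  Fin.snoc (α := fun _ => ℝ × ℝ) (fun i => (1 / 2 : ℝ) • x i.castSucc) (1 / 2, 1)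

theorem halve_mem {m : ℕ} {x : Fin (m + 1) → ℝ × ℝ} (hx : x ∈ intervalSet (m + 1)) :
    halve x ∈ intervalSet (m + 1) := by
  constructor
  · intro i
    refine Fin.lastCases ?_ (fun i => ?_) i
    · simp only [halve, Fin.snoc_last]
      norm_num
    · obtain ⟨h1, h2, h3⟩ := hx.1 i.castSucc
      simp only [halve, Fin.snoc_castSucc, Prod.smul_fst, Prod.smul_snd, smul_eq_mul]
      exact ⟨by linarith, by linarith, by linarith⟩
  · intro i k
    refine Fin.lastCases (fun h => ?_) (fun i => ?_) i
    · exact absurd h (Fin.le_last k).not_gt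
    · refine Fin.lastCases (fun _ => ?_) (fun k h => ?_) k
      · have h3 := (hx.1 i.castSucc).2.2
        simp only [halve, Fin.snoc_last, Fin.snoc_castSucc, Prod.smul_snd, smul_eq_mul]
        linarith
      · have h3 := hx.2 _ _ h
        simp only [halve, Fin.snoc_castSucc, Prod.smul_fst, Prod.smul_snd, smul_eq_mul]
        linarith

theorem continuous_halve {m : ℕ} : Continuous (halve (m := m)) := by
  refine continuous_pi fun i => Fin.lastCases ?_ (fun i => ?_) i
  · simp only [halve, Fin.snoc_last]
    exact continuous_const
  · simp only [halve, Fin.snoc_castSucc]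
    fun_prop

/-- The straight line from `halve x` to `x`. -/
def contractFun {m : ℕ} (t : ℝ) (x : Fin (m + 1) → ℝ × ℝ) : Fin (m + 1) → ℝ × ℝ :=
  (1 - t) • halve x + t • x

theorem contractFun_mem {m : ℕ} {t : ℝ} (ht : t ∈ Set.Icc (0 : ℝ) 1) {x : Fin (m + 1) → ℝ × ℝ}
    (hx : x ∈ intervalSet (m + 1)) : contractFun t x ∈ intervalSet (m + 1) :=
  convex_intervalSet _ (halve_mem hx) hx (sub_nonneg.2 ht.2) ht.1 (sub_add_cancel 1 t)

/-- Effect of `contractFun` on the last interval. -/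
def contractLast (t : ℝ) (p : ℝ × ℝ) : ℝ × ℝ := (1 - t) • (1 / 2, 1) + t • p

/-- Since `(1 - t)/2 + t = (1 + t)/2`, all intervals but the last are composed on the outside with
`[0, (1 + t)/2]`, and the last moves independently of them. The compatibility with the relations
depends on this shape. -/
theorem ofFn_contractFun {m : ℕ} {t : ℝ} {x : Fin (m + 1) → ℝ × ℝ} {c : List (ℝ × ℝ)} {r : ℝ × ℝ}
    (h : List.ofFn x = c ++ [r]) : List.ofFn (contractFun t x) =
      c.map (rescale (0, (1 + t) / 2)) ++ [contractLast t r] := by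
  rw [List.ofFn_succ_last] at h
  obtain ⟨h1, h2⟩ := List.append_inj' h rfl
  rw [List.ofFn_succ_last, ← h1, ← List.singleton_inj.1 h2, List.map_ofFn]
  refine congrArg₂ (fun f a => List.ofFn f ++ [a]) (funext fun i => ?_) ?_
  · simp only [contractFun, halve, rescale, Pi.add_apply, Pi.smul_apply, Fin.snoc_castSucc,
      Function.comp_apply]
    ext <;> simp <;> ring
  · simp [contractFun, halve, contractLast]

variable {P : ObjectProperty TopCat.{w}} [ContainsConvexSets P]

/-- A point of the unit interval as a real number. -/
def coord (t : (unitInterval P).obj) : ℝ := (ULift.down (α := Set.Icc (0 : ℝ) 1) t).1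

variable (P) in
/-- A real number in the unit interval as a point. -/
def ofCoord (t : Set.Icc (0 : ℝ) 1) : (unitInterval P).obj := ULift.up t

@[simp] theorem coord_ofCoord (t : Set.Icc (0 : ℝ) 1) : coord (ofCoord P t) = t.1 := rfl

theorem coord_mem (t : (unitInterval P).obj) : coord t ∈ Set.Icc (0 : ℝ) 1 :=
  (ULift.down (α := Set.Icc (0 : ℝ) 1) t).2

theorem continuous_coord : Continuous (coord (P := P)) :=
  continuous_subtype_val.comp continuous_uliftDown

/-- The point of the space of little intervals given by a tuple of intervals. -/
def ofEndpoints {m : ℕ} (x : Fin m → ℝ × ℝ) (hx : x ∈ intervalSet m) : (intervals P m).obj :=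
  ULift.up ⟨x, hx⟩

theorem toList_ofEndpoints {m : ℕ} (x : Fin m → ℝ × ℝ) (hx : x ∈ intervalSet m) :
    toList (P := P) (ofEndpoints x hx) = List.ofFn x := rfl

variable (P) in
/-- The path from `[0, 1/2]` to `[0, 1]` which moves the right endpoint linearly. -/
def growPath : unitInterval P ⟶ intervals P 1 :=
  ObjectProperty.homMk (TopCat.ofHom
    { toFun := fun t : (unitInterval P).obj =>
        ofEndpoints (P := P) (fun _ => (0, (1 + coord t) / 2)) (by
        have h := coord_mem t
        refine ⟨fun i => ⟨le_rfl, ?_, ?_⟩,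
          fun i k hik => absurd hik (by simp [Subsingleton.elim i k])⟩
        · have := h.1
          change 0 < (1 + coord t) / 2
          linarith
        · have := h.2
          change (1 + coord t) / 2 ≤ 1
          linarith)
      continuous_toFun := by
        refine continuous_uliftUp.comp (Continuous.subtype_mk ?_ _)
        have := continuous_coord (P := P)
        exact continuous_pi fun _ => continuous_const.prodMk
          ((continuous_const.add this).div_const 2) })

theorem toList_growPath (t : (unitInterval P).obj) :
    toList (value (growPath P) t) = [(0, (1 + coord t) / 2)] :=
  List.ofFn_succ.trans rfl

variable (P) in
/-- The point `[0, 1/2], [1/2, 1]`. -/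
def halves : (intervals P 2).obj :=
  ofEndpoints ![(0, 1 / 2), (1 / 2, 1)] (by
    constructor
    · intro i
      fin_cases i <;> norm_num
    · intro i k
      fin_cases i <;> fin_cases k <;> norm_num)

theorem toList_halves : toList (halves P) = [(0, 1 / 2)] ++ [(1 / 2, 1)] := by
  refine (toList_ofEndpoints (P := P) _ _).trans ?_
  simp

variable [CartesianMonoidalCategory P.FullSubcategory]

variable (P) in
/-- The homotopy `contractFun` on spaces of little intervals. -/
def contract (m : ℕ) : unitInterval P ⊗ intervals P (m + 1) ⟶ intervals P (m + 1) :=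
  ObjectProperty.homMk (TopCat.ofHom
    { toFun := fun p : (unitInterval P ⊗ intervals P (m + 1)).obj =>
        ofEndpoints (P := P) (contractFun (coord (left p)) (endpoints (right p)))
        (contractFun_mem (coord_mem _) (endpoints_mem _))
      continuous_toFun := by
        refine continuous_uliftUp.comp (Continuous.subtype_mk ?_ _)
        have h1 : Continuous fun p : (unitInterval P ⊗ intervals P (m + 1)).obj =>
            coord (left p) := continuous_coord.comp (fst (unitInterval P)
              (intervals P (m + 1))).hom.hom.continuous
        have h2 : Continuous fun p : (unitInterval P ⊗ intervals P (m + 1)).obj =>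
            endpoints (right p) := continuous_endpoints.comp (snd (unitInterval P)
              (intervals P (m + 1))).hom.hom.continuous
        exact ((continuous_const.sub h1).smul (continuous_halve.comp h2)).add (h1.smul h2) })

theorem toList_contract {m : ℕ} {p : (unitInterval P ⊗ intervals P (m + 1)).obj}
    {c : List (ℝ × ℝ)} {r : ℝ × ℝ} (h : toList (right p) = c ++ [r]) :
    toList (value (contract P m) p) =
      c.map (rescale (0, (1 + coord (left p)) / 2)) ++ [contractLast (coord (left p)) r] :=
  ofFn_contractFun (t := coord (left p)) h

/-- Outer composition on the first `m` intervals commutes with plugging operations into them, and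
the last interval, which receives the unit, is not affected by the plugging. -/
theorem contract_composeOne {m : ℕ} (j : Arities m) :
    unitInterval P ◁ composeOne j ≫ contract P j.sum =
      (α_ _ _ _).inv ≫ contract P m ▷ tensorFam (intervals P) j ≫ composeOne j :=
  intervals_hom_ext fun x => by
    obtain ⟨c, r, hc, h⟩ := exists_toList_eq_concat (left (right x))
    rw [value_comp, value_comp, value_comp, toList_contract
      ((congrArg toList (right_whiskerLeft _ _)).trans (toList_composeOne_of_eq hc h)),
      toList_composeOne_of_eq (c := c.map (rescale (0, (1 + coord (left x)) / 2)))
        (r := contractLast (coord (left x)) r) (by simp [hc]), composeList_map_rescale]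
    · simp
    · rw [left_whiskerRight, toList_contract (c := c) (r := r)] <;> simp [h]

variable (P) in
/-- The map which forgets the last interval. -/
def dropLast (m : ℕ) : intervals P (m + 1) ⟶ intervals P m :=
  (ρ_ _).inv ≫ intervals P (m + 1) ◁ emptyIntervals P ≫ composeLast P m 0

theorem toList_emptyIntervals (t : (𝟙_ P.FullSubcategory).obj) :
    toList (value (emptyIntervals P) t) = [] := by
  simp [toList]

theorem toList_dropLast {m : ℕ} {x : (intervals P (m + 1)).obj}
    {c : List (ℝ × ℝ)} {r : ℝ × ℝ} (hc : c.length = m) (h : toList x = c ++ [r]) :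
    toList (value (dropLast P m) x) = c := by
  rw [dropLast, value_comp, value_comp]
  refine (toList_composeLast_of_eq (q := 0) (c := c) (r := r) hc ?_).trans ?_
  · rw [left_whiskerLeft, left_rightUnitor_inv, h]
  · rw [right_whiskerLeft, toList_emptyIntervals, List.map_nil, List.append_nil]

variable (P) in
/-- The canonical isomorphism from `C(m)` to a product with one factor. -/
def singleInput (m : ℕ) : intervals P m ⟶ tensorFam (intervals P) (Arities.snoc Arities.nil m) :=
  (λ_ (intervals P m)).inv

theorem famToList_singleInput {m : ℕ} (x : (intervals P m).obj) :
    famToList (Arities.snoc Arities.nil m) (value (singleInput P m) x) = [toList x] :=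
  congrArg (fun l => [l]) (congrArg toList (right_leftUnitor_inv x))

theorem contract_one (m : ℕ) : restrictAt (contract P m) (ofCoord P 1) = 𝟙 _ :=
  intervals_hom_ext fun x => by
    obtain ⟨c, r, hc, h⟩ := exists_toList_eq_concat x
    obtain ⟨p, hp, ht, hx⟩ := exists_value_restrictAt (contract P m) (ofCoord P 1) x
    rw [hp, toList_contract (c := c) (r := r) (by rw [hx, h]), ht, value_id, h, coord_ofCoord]
    norm_num [contractLast, funext zero_one_rescale]

/-- At time `0` the list `c ++ [r]` has become `c` halved followed by `[1/2, 1]`, which is `c`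
plugged into the first input of `halves`; so `r` no longer matters. The cast is along `0 + m = m`,
the sum of the tuple `(m)`. -/
theorem contract_zero (m : ℕ) : restrictAt (contract P m) (ofCoord P 0) =
    dropLast P m ≫ restrictAt (intervals P 2 ◁ singleInput P m ≫
      composeOne (Arities.snoc Arities.nil m)) (halves P) ≫
        castObj (intervals P) (congrArg (· + 1) (Nat.zero_add m)) :=
  intervals_hom_ext fun x => by
    obtain ⟨c, r, hc, h⟩ := exists_toList_eq_concat x
    obtain ⟨p, hp, ht, hx⟩ := exists_value_restrictAt (contract P m) (ofCoord P 0) x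
    rw [value_comp, value_comp]
    refine Eq.trans ?_ (toList_castObj _ _).symm
    obtain ⟨q, hq, ht', hx'⟩ := exists_value_restrictAt (intervals P 2 ◁ singleInput P m ≫
      composeOne (Arities.snoc Arities.nil m)) (halves P) (value (dropLast P m) x)
    refine Eq.trans ?_ (congrArg toList (hq.trans (value_comp _ _ _))).symm
    -- `halves` is read as one ordinary input `[0, 1/2]` followed by the free slot `[1/2, 1]`.
    refine Eq.trans ?_ (toList_composeOne_of_eq (m := 1) (j := Arities.snoc Arities.nil m)
      (c := [(0, 1 / 2)]) (r := (1 / 2, 1)) rfl ?_).symm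
    · rw [hp, toList_contract (c := c) (r := r) (by rw [hx, h]), ht, coord_ofCoord]
      rw [right_whiskerLeft, famToList_singleInput, hx', toList_dropLast hc h]
      simp [composeList, contractLast]
    · rw [left_whiskerLeft, ht', toList_halves]

end Contraction

/-! ### Endpoints of the path of unary operations -/

section Space

variable {P : ObjectProperty TopCat.{w}} [ContainsConvexSets P]
  [CartesianMonoidalCategory P.FullSubcategory]

theorem constMap_growPath_zero : constMap (X := 𝟙_ P.FullSubcategory) (ofCoord P 0) ≫ growPath P =
    constMap (halves P) ≫ dropLast P 1 :=
  intervals_hom_ext fun x => by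
    rw [value_comp, value_comp, value_constMap, value_constMap, toList_growPath,
      toList_dropLast (m := 1) rfl toList_halves]
    simp

theorem constMap_growPath_one : constMap (X := 𝟙_ P.FullSubcategory) (ofCoord P 1) ≫ growPath P =
    unitPoint P :=
  intervals_hom_ext fun x => by
    rw [value_comp, value_constMap, toList_growPath, toList_unitPoint]
    simp

end Space

/-! ### The contraction in `M` and its descent to `env A` -/

section Enriched

variable {P : ObjectProperty TopCat.{w}} [CartesianMonoidalCategory P.FullSubcategory]
  {M : Type u} [Category.{v} M] [MonoidalCategory M] (L : P.FullSubcategory ⥤ M) [L.Monoidal]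

/-- The map `1 ⟶ L X` given by a point of `X`. -/
def mapPoint {X : P.FullSubcategory} (x : X.obj) : 𝟙_ M ⟶ L.obj X :=
  ε L ≫ L.map (constMap x)

theorem leftUnitor_inv_mapPoint {X Y Z : P.FullSubcategory} (h : X ⊗ Y ⟶ Z) (x : X.obj) :
    (λ_ (L.obj Y)).inv ≫ mapPoint L x ▷ L.obj Y ≫ μ L X Y ≫ L.map h = L.map (restrictAt h x) := by
  rw [mapPoint, comp_whiskerRight_assoc, μ_natural_left_assoc, left_unitality_inv_assoc,
    ← L.map_comp, ← L.map_comp, restrictAt]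

variable [ContainsConvexSets P]

theorem inclAt_braiding [SymmetricCategory M] {X Y : M} (t : Set.Icc (0 : ℝ) 1)
    (h : L.obj (unitInterval P) ⊗ X ⟶ Y) : inclAt L X t ≫ (β_ _ _).hom ≫ h =
      (λ_ X).inv ≫ mapPoint L (ofCoord P t) ▷ X ≫ h := by
  have := BraidedCategory.braiding_naturality_right_assoc X (mapPoint L (ofCoord P t)) h
  refine (Category.assoc _ _ _).trans ((congrArg _ this).trans ?_)
  simp

/-- A homotopy may be given with the factor `L([0, 1])` on the left. -/
theorem Homotopic.of_left [SymmetricCategory M] {X Y : M} {f g : X ⟶ Y}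
    (h : L.obj (unitInterval P) ⊗ X ⟶ Y)
    (hf : (λ_ X).inv ≫ mapPoint L (ofCoord P 0) ▷ X ≫ h = f)
    (hg : (λ_ X).inv ≫ mapPoint L (ofCoord P 1) ▷ X ≫ h = g) : Homotopic L f g :=
  ⟨(β_ _ _).hom ≫ h, by rw [inclAt_braiding, hf], by rw [inclAt_braiding, hg]⟩

variable (P) in
/-- The image of the operad of little intervals. -/
abbrev enriched : OperadData M := (littleIntervals P).map L

theorem map_composeOne_contract {m : ℕ} (j : Arities m) :
    L.obj (unitInterval P) ◁ (enriched P L).compOne j ≫ μ L (unitInterval P) _ ≫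
        L.map (contract P j.sum) =
      (α_ _ _ _).inv ≫ (μ L _ _ ≫ L.map (contract P m)) ▷
        tensorFam (fun n => L.obj (intervals P n)) j ≫ (enriched P L).compOne j := by
  rw [OperadData.map_compOne]
  have key : ∀ {U X S Y : P.FullSubcategory} {T : M} (t : T ⟶ L.obj S) (c : X ⊗ S ⟶ Y)
      (h : U ⊗ X ⟶ X) (h' : U ⊗ Y ⟶ Y), U ◁ c ≫ h' = (α_ _ _ _).inv ≫ h ▷ S ≫ c →
      L.obj U ◁ (L.obj X ◁ t ≫ μ L X S ≫ L.map c) ≫ μ L U Y ≫ L.map h' =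
      (α_ _ _ _).inv ≫ (μ L U X ≫ L.map h) ▷ T ≫ L.obj X ◁ t ≫ μ L X S ≫ L.map c := by
    intro U X S Y T t c h h' e
    have e' := congrArg (fun f => L.map f) e
    simp only [L.map_comp] at e'
    simp only [MonoidalCategory.whiskerLeft_comp, Category.assoc, μ_natural_right_assoc, e',
      associativity_inv_assoc]
    rw [comp_whiskerRight_assoc, ← whisker_exchange_assoc, μ_natural_left_assoc,
      ← whisker_exchange_assoc]
    simp
  exact key _ _ _ _ (contract_composeOne j)

variable [SymmetricCategory M] (A : OperadAlgebra (enriched P L))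

/-- The homotopy on `L C(m+1) ⊗ A^(m)` induced by the contraction of little intervals. -/
def summandContract (m : ℕ) : L.obj (unitInterval P) ⊗ A.envSummand m ⟶ A.envSummand m :=
  (α_ _ (L.obj (intervals P (m + 1))) (tensorPow A.X m)).inv ≫
    (μ L _ _ ≫ L.map (contract P m)) ▷ tensorPow A.X m

/-- The homotopy on a relation induced by the contraction of little intervals. -/
def relationContract {m : ℕ} (j : Arities m) :
    L.obj (unitInterval P) ⊗ A.envRelation ⟨m, j⟩ ⟶ A.envRelation ⟨m, j⟩ :=
  (α_ _ (L.obj (intervals P (m + 1)))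
      (tensorFam (fun n => L.obj (intervals P n) ⊗ tensorPow A.X n) j)).inv ≫
    (μ L _ _ ≫ L.map (contract P m)) ▷
      tensorFam (fun n => L.obj (intervals P n) ⊗ tensorPow A.X n) j

/-- The contraction moves the operad factor and the action maps move the other factor, so they
commute by the exchange law for `⊗`. -/
theorem summandContract_act {m : ℕ} (j : Arities m) :
    L.obj (unitInterval P) ◁ A.relationAct j ≫ summandContract L A m =
      relationContract L A j ≫ A.relationAct j := by
  have key : ∀ {K U V X Y : M} (g : X ⟶ Y) (h : K ⊗ U ⟶ V),
      K ◁ (U ◁ g) ≫ (α_ _ _ _).inv ≫ h ▷ Y = ((α_ _ _ _).inv ≫ h ▷ X) ≫ V ◁ g := by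
    intros
    rw [Category.assoc, associator_inv_naturality_right_assoc, whisker_exchange]
  exact key _ _

/-- Reduces to the commutation of the contraction with `composeOne`, carried over to `M`; the powers
of `A` are bystanders. -/
theorem summandContract_comp {m : ℕ} (j : Arities m) :
    L.obj (unitInterval P) ◁ A.relationComp j ≫ summandContract L A j.sum =
      relationContract L A j ≫ A.relationComp j := by
  have key : ∀ {K U V X Y B : M} (g : X ⟶ Y ⊗ B) (h : K ⊗ U ⟶ U) (c : U ⊗ Y ⟶ V)
      (h' : K ⊗ V ⟶ V), K ◁ c ≫ h' = (α_ _ _ _).inv ≫ h ▷ Y ≫ c →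
      K ◁ (U ◁ g ≫ (α_ _ _ _).inv ≫ c ▷ B) ≫ (α_ _ _ _).inv ≫ h' ▷ B =
        ((α_ _ _ _).inv ≫ h ▷ X) ≫ U ◁ g ≫ (α_ _ _ _).inv ≫ c ▷ B := by
    intro K U V X Y B g h c h' e
    have e' := congrArg (fun f => f ▷ B) e
    simp only [comp_whiskerRight] at e'
    simp only [MonoidalCategory.whiskerLeft_comp, Category.assoc,
      associator_inv_naturality_middle_assoc, e']
    rw [← whisker_exchange_assoc, associator_inv_naturality_left_assoc]
    simp
  exact key _ _ _ _ (map_composeOne_contract L j)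

theorem leftUnitor_inv_summandContract (m : ℕ) (t : Set.Icc (0 : ℝ) 1) :
    (λ_ (A.envSummand m)).inv ≫ mapPoint L (ofCoord P t) ▷ A.envSummand m ≫
        summandContract L A m =
      (L.map (restrictAt (contract P m) (ofCoord P t)) ▷ tensorPow A.X m :
        L.obj (intervals P (m + 1)) ⊗ tensorPow A.X m ⟶ _) := by
  rw [← leftUnitor_inv_mapPoint]
  have key : ∀ {K U V B : M} (k : 𝟙_ M ⟶ K) (h : K ⊗ U ⟶ V), (λ_ (U ⊗ B)).inv ≫ k ▷ (U ⊗ B) ≫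
      (α_ _ _ _).inv ≫ h ▷ B = ((λ_ U).inv ≫ k ▷ U ≫ h) ▷ B := by
    intros
    simp
  exact key _ _

variable [HasCountableColimits M] [MonoidalClosed M]

theorem exists_envContract : ∃ H : L.obj (unitInterval P) ⊗ A.env ⟶ A.env, ∀ m,
    L.obj (unitInterval P) ◁ A.summandι m ≫ H = summandContract L A m ≫ A.summandι m :=
  A.exists_tensor_env_desc _ fun {m} j => by
    rw [reassoc_of% summandContract_act L A j, reassoc_of% summandContract_comp L A j,
      A.relationAct_summandι]

end Enriched

/-! ### The orbit map: linearity and values on summands -/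

section ModuleMap

variable {M : Type u} [Category.{v} M] [MonoidalCategory M] [SymmetricCategory M]
  {O : OperadData M} {A : OperadAlgebra O}

/-- Acting on an element given by a nullary operation amounts to inserting the operation. -/
theorem OperadAlgebra.summandSmul_nullary (A : OperadAlgebra O) (o : 𝟙_ M ⟶ O.obj 0) (m : ℕ) :
    (ρ_ (A.envSummand m)).inv ≫ A.envSummand m ◁ (o ≫ (ρ_ (O.obj 0)).inv ≫ A.act 0) ≫
        A.summandSmul m =
      ((ρ_ (O.obj (m + 1))).inv ≫ O.obj (m + 1) ◁ o ≫ O.compLastOp m 0) ▷ tensorPow A.X m ≫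
        A.act m := by
  -- The hypothesis is `act_last` at `q = 0`, where `A^(0)` is the unit object.
  have key : ∀ {U V B Z X Y : M} (o : 𝟙_ M ⟶ Z) (z : Z ⊗ 𝟙_ M ⟶ X) (c : U ⊗ Z ⟶ V)
      (a : V ⊗ B ⟶ Y) (a' : U ⊗ (B ⊗ X) ⟶ Y),
      tensorμ U B Z (𝟙_ M) ≫ (c ⊗ₘ (ρ_ B).hom) ≫ a = (α_ _ _ _).hom ≫ U ◁ B ◁ z ≫ a' →
      (ρ_ (U ⊗ B)).inv ≫ (U ⊗ B) ◁ (o ≫ (ρ_ Z).inv ≫ z) ≫ (α_ _ _ _).hom ≫ a' =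
        ((ρ_ U).inv ≫ U ◁ o ≫ c) ▷ B ≫ a := by
    intro U V B Z X Y o z c a a' h
    have h1 := tensorμ_natural (𝟙 U) (𝟙 B) o (𝟙 (𝟙_ M))
    have h2 := tensor_right_unitality U B
    simp only [id_tensorHom, tensorHom_id, id_whiskerRight] at h1
    have h3 : (ρ_ (U ⊗ B)).inv ≫ (U ⊗ B) ◁ (ρ_ (𝟙_ M)).inv ≫ tensorμ U B (𝟙_ M) (𝟙_ M) =
        ((ρ_ U).inv ⊗ₘ (ρ_ B).inv) := by
      rw [← cancel_mono ((ρ_ U).hom ⊗ₘ (ρ_ B).hom)]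
      rw [Category.assoc, Category.assoc, ← unitors_inv_equal, ← h2]
      simp
    have h4 : (U ⊗ B) ◁ (o ≫ (ρ_ Z).inv ≫ z) ≫ (α_ _ _ _).hom =
        (U ⊗ B) ◁ (ρ_ (𝟙_ M)).inv ≫ (U ⊗ B) ◁ (o ▷ 𝟙_ M) ≫ (α_ _ _ _).hom ≫ U ◁ B ◁ z := by
      simp
    rw [reassoc_of% h4, ← h, reassoc_of% h1, reassoc_of% h3]
    simp [MonoidalCategory.tensorHom_def]
  exact key o (A.act 0) (O.compLastOp m 0) (A.act m) (A.act (m + 1)) (A.act_last m 0)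

variable [HasCountableColimits M]

/-- `u ↦ u · e` is linear for every `e`, because `(u v) · e = u · (v · e)`. -/
theorem OperadAlgebra.EnvStructure.isModuleMap_orbitMap (E : A.EnvStructure) (e : 𝟙_ M ⟶ A.X) :
    E.IsModuleMap (E.orbitMap e) := by
  let _ := E.mon
  let _ := E.mod
  let _ := ModObj.regular A.env
  refine ⟨?_⟩
  have h : E.mon.mul ▷ A.X ≫ E.mod.smul = (α_ _ _ _).hom ≫ A.env ◁ E.mod.smul ≫ E.mod.smul :=
    ModObj.mul_smul (M := A.env) (X := A.X)
  change E.mon.mul ≫ (ρ_ A.env).inv ≫ A.env ◁ e ≫ E.mod.smul =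
    A.env ◁ ((ρ_ A.env).inv ≫ A.env ◁ e ≫ E.mod.smul) ≫ E.mod.smul
  rw [rightUnitor_inv_naturality_assoc, ← whisker_exchange_assoc, h]
  simp

theorem OperadAlgebra.EnvStructure.summandι_orbitMap (E : A.EnvStructure) (e : 𝟙_ M ⟶ A.X) (m : ℕ) :
    A.summandι m ≫ E.orbitMap e =
      (ρ_ (A.envSummand m)).inv ≫ A.envSummand m ◁ e ≫ A.summandSmul m := by
  have h : A.summandι m ▷ A.X ≫ E.mod.smul = A.summandSmul m := E.ι_smul m
  rw [orbitMap, rightUnitor_inv_naturality_assoc, ← whisker_exchange_assoc, h]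

/-- The relation of `env A` for a binary operation applied to one factor. -/
theorem OperadAlgebra.act_summandι_one (A : OperadAlgebra O) (o : 𝟙_ M ⟶ O.obj 2) (m : ℕ) :
    A.act m ≫ (λ_ A.X).inv ≫ (o ⊗ₘ toPowOne A.X) ≫ A.summandι 1 =
      (((λ_ (O.obj m)).inv ≫ o ▷ O.obj m ≫ O.obj 2 ◁ (λ_ (O.obj m)).inv ≫
        O.compOne (Arities.snoc Arities.nil m)) ≫
          castObj O.obj (congrArg (· + 1) (Nat.zero_add m))) ▷ tensorPow A.X m ≫
        A.summandι m := by
  have hc : ∀ {k n : ℕ} (h : k = n), O.obj (k + 1) ◁ castObj (tensorPow A.X) h.symm ≫ A.envι k =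
      castObj O.obj (congrArg (· + 1) h) ▷ tensorPow A.X n ≫ A.envι n := by
    intro k n h
    subst h
    simp
  -- The maps `i` and `i'` stand for the inclusions of summands, and the second hypothesis is the
  -- defining relation of `env A` at the one-entry tuple `(m)`.
  have key : ∀ {Z W X B B' V E : M} (o : 𝟙_ M ⟶ Z) (f : W ⊗ B ⟶ X) (p : 𝟙_ M ⊗ B ⟶ B')
      (q : B ⟶ B') (c : Z ⊗ (𝟙_ M ⊗ W) ⟶ V) (i : Z ⊗ (𝟙_ M ⊗ X) ⟶ E) (i' : V ⊗ B' ⟶ E),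
      p = (λ_ B).hom ≫ q →
      Z ◁ (𝟙 (𝟙_ M) ⊗ₘ f) ≫ i = (Z ◁ (((λ_ (𝟙_ M)).inv ▷ (W ⊗ B) ≫ tensorμ (𝟙_ M) (𝟙_ M) W B) ≫
        (𝟙_ M ⊗ W) ◁ (𝟙 (𝟙_ M) ▷ B ≫ p)) ≫ (α_ _ _ _).inv ≫ c ▷ B') ≫ i' →
      f ≫ (λ_ X).inv ≫ (o ⊗ₘ (λ_ X).inv) ≫ i =
        ((λ_ W).inv ≫ o ▷ W ≫ Z ◁ (λ_ W).inv ≫ c) ▷ B ≫ V ◁ q ≫ i' := by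
    intro Z W X B B' V E o f p q c i i' hp h
    subst hp
    have h3 : (λ_ (W ⊗ B)).inv ≫ (λ_ (𝟙_ M)).inv ▷ (W ⊗ B) ≫ tensorμ (𝟙_ M) (𝟙_ M) W B =
        ((λ_ W).inv ⊗ₘ (λ_ B).inv) := by
      rw [← cancel_mono ((λ_ W).hom ⊗ₘ (λ_ B).hom)]
      rw [Category.assoc, Category.assoc, ← tensor_left_unitality]
      simp
    have h4 : f ≫ (λ_ X).inv ≫ (o ⊗ₘ (λ_ X).inv) =
        (λ_ (W ⊗ B)).inv ≫ o ▷ (W ⊗ B) ≫ Z ◁ (λ_ (W ⊗ B)).inv ≫ Z ◁ (𝟙 (𝟙_ M) ⊗ₘ f) := by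
      rw [id_tensorHom, ← MonoidalCategory.whiskerLeft_comp, ← leftUnitor_inv_naturality,
        ← whisker_exchange, ← leftUnitor_inv_naturality_assoc, tensorHom_def',
        Category.assoc, leftUnitor_inv_naturality_assoc (λ_ X).inv]
    rw [reassoc_of% h4, h]
    simp only [MonoidalCategory.whiskerLeft_comp, Category.assoc]
    rw [← MonoidalCategory.whiskerLeft_comp_assoc, ← MonoidalCategory.whiskerLeft_comp_assoc,
      Category.assoc, h3]
    simp only [MonoidalCategory.tensorHom_def, id_whiskerRight, MonoidalCategory.whiskerLeft_comp,
      MonoidalCategory.whiskerLeft_id, Category.assoc, Category.id_comp]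
    have h5 : Z ◁ (𝟙_ M ⊗ W) ◁ q ≫ (α_ _ _ _).inv ≫ c ▷ B' =
        (α_ _ _ _).inv ≫ c ▷ B ≫ V ◁ q := by
      rw [associator_inv_naturality_right_assoc, whisker_exchange]
    rw [reassoc_of% h5]
    simp
  refine (key o (A.act m) _ _ (O.compOne (Arities.snoc Arities.nil m)) (A.summandι 1)
    (A.summandι (0 + m)) (tensorPowAdd_zero_left A.X m)
    (A.relationAct_summandι (Arities.snoc Arities.nil m))).trans ?_
  have key' : ∀ {T U V B E : M} (a : T ⟶ U) (b : U ⟶ V) (i : V ⊗ B ⟶ E) (i' : U ⊗ B ⟶ E),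
      i' = b ▷ B ≫ i → a ▷ B ≫ i' = (a ≫ b) ▷ B ≫ i := by
    intro _ _ _ _ _ a b i i' h
    rw [h, comp_whiskerRight_assoc]
  exact key' _ _ _ _ (hc (Nat.zero_add m))

end ModuleMap

/-! ### The two homotopies -/

section Equivalence

variable {P : ObjectProperty TopCat.{w}} [ContainsConvexSets P]
  [CartesianMonoidalCategory P.FullSubcategory]
  {M : Type u} [Category.{v} M] [MonoidalCategory M] (L : P.FullSubcategory ⥤ M) [L.Monoidal]

theorem map_dropLast (m : ℕ) :
    (ρ_ (L.obj (intervals P (m + 1)))).inv ≫ L.obj (intervals P (m + 1)) ◁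
      (ε L ≫ L.map (emptyIntervals P)) ≫ (enriched P L).compLastOp m 0 =
        L.map (dropLast P m) := by
  rw [OperadData.map_compLastOp]
  have key : ∀ {X Y Z : P.FullSubcategory} (e : 𝟙_ _ ⟶ Y) (c : X ⊗ Y ⟶ Z),
      (ρ_ (L.obj X)).inv ≫ L.obj X ◁ (ε L ≫ L.map e) ≫ μ L X Y ≫ L.map c =
        L.map ((ρ_ X).inv ≫ X ◁ e ≫ c) := by
    intros
    rw [MonoidalCategory.whiskerLeft_comp_assoc, μ_natural_right_assoc,
      right_unitality_inv_assoc, ← L.map_comp, ← L.map_comp]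
  exact key (emptyIntervals P) (composeLast P m 0)

theorem map_composeOne_singleInput (m : ℕ) :
    (λ_ (L.obj (intervals P m))).inv ≫ mapPoint L (halves P) ▷ L.obj (intervals P m) ≫
        L.obj (intervals P 2) ◁ (λ_ (L.obj (intervals P m))).inv ≫
          (enriched P L).compOne (Arities.snoc Arities.nil m) =
      L.map (restrictAt (intervals P 2 ◁ singleInput P m ≫
        composeOne (Arities.snoc Arities.nil m)) (halves P)) := by
  rw [OperadData.map_compOne]
  have key : ∀ {X Y Z : P.FullSubcategory} (x : X.obj) (c : X ⊗ (𝟙_ _ ⊗ Y) ⟶ Z),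
      (λ_ (L.obj Y)).inv ≫ mapPoint L x ▷ L.obj Y ≫ L.obj X ◁ (λ_ (L.obj Y)).inv ≫
        L.obj X ◁ (ε L ▷ L.obj Y ≫ μ L _ _) ≫ μ L _ _ ≫ L.map c =
      L.map (restrictAt (X ◁ (λ_ Y).inv ≫ c) x) := by
    intro X Y Z x c
    rw [← leftUnitor_inv_mapPoint, L.map_comp, ← μ_natural_right_assoc, ← left_unitality_inv]
    simp only [MonoidalCategory.whiskerLeft_comp, Category.assoc]
  exact key (halves P) (composeOne (Arities.snoc Arities.nil m))

variable [SymmetricCategory M] (A : OperadAlgebra (enriched P L))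

/-- The action on `A` of `O(m+1)`, through the map which forgets the last interval. -/
theorem summandSmul_algebraUnit (m : ℕ) :
    (ρ_ (A.envSummand m)).inv ≫ A.envSummand m ◁ algebraUnit L A ≫ A.summandSmul m =
      L.map (dropLast P m) ▷ tensorPow A.X m ≫ A.act m := by
  have h := A.summandSmul_nullary (ε L ≫ L.map (emptyIntervals P)) m
  refine (congrArg (fun e => (ρ_ (A.envSummand m)).inv ≫ A.envSummand m ◁ e ≫ A.summandSmul m)
    (Category.assoc _ _ _).symm).trans (h.trans ?_)
  exact congrArg (fun f => f ▷ tensorPow A.X m ≫ A.act m) (map_dropLast L m)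

variable [HasCountableColimits M]

/-- The homotopy inverse of the map from the enveloping algebra to the algebra. -/
def homotopyInverse : A.X ⟶ A.env :=
  (λ_ A.X).inv ≫ (mapPoint L (halves P) ⊗ₘ toPowOne A.X) ≫ A.summandι 1

/-- The relation for a one-entry tuple moves the action out of the algebra factor and into the first
input of `halves`; the resulting operation is the contraction at time `0`, by `contract_zero`. -/
theorem act_homotopyInverse (m : ℕ) :
    L.map (dropLast P m) ▷ tensorPow A.X m ≫ A.act m ≫ homotopyInverse L A =
      L.map (restrictAt (contract P m) (ofCoord P 0)) ▷ tensorPow A.X m ≫ A.summandι m := by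
  rw [contract_zero, L.map_comp, L.map_comp, map_castObj]
  have key : ∀ {X Y Z V B T S : M} (d : X ⟶ Y) (a : Y ⊗ B ⟶ T) (g : T ⟶ S) (p p' : Y ⟶ Z)
      (q : Z ⟶ V) (i : V ⊗ B ⟶ S), a ≫ g = (p ≫ q) ▷ B ≫ i → p = p' →
      d ▷ B ≫ a ≫ g = (d ≫ p' ≫ q) ▷ B ≫ i := by
    intro X Y Z V B T S d a g p p' q i h hp
    rw [h, hp, ← comp_whiskerRight_assoc]
  exact key (L.map (dropLast P m)) (A.act m) (homotopyInverse L A) _ _ _ _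
    (A.act_summandι_one (mapPoint L (halves P)) m) (map_composeOne_singleInput L m)

theorem homotopic_orbitMap_comp [MonoidalClosed M] (E : A.EnvStructure) :
    Homotopic L (E.orbitMap (algebraUnit L A) ≫ homotopyInverse L A) (𝟙 A.env) := by
  obtain ⟨H, hH⟩ := exists_envContract L A
  have key (t : Set.Icc (0 : ℝ) 1) (m : ℕ) : A.summandι m ≫ (λ_ A.env).inv ≫
      mapPoint L (ofCoord P t) ▷ A.env ≫ H =
        (L.map (restrictAt (contract P m) (ofCoord P t)) ▷ tensorPow A.X m :
          A.envSummand m ⟶ A.envSummand m) ≫ A.summandι m := by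
    rw [leftUnitor_inv_naturality_assoc, whisker_exchange_assoc, hH]
    exact ((Category.assoc _ _ _).trans (congrArg _ (Category.assoc _ _ _))).symm.trans
      (congrArg (· ≫ A.summandι m) (leftUnitor_inv_summandContract L A m t))
  refine Homotopic.of_left L H (A.env_hom_ext fun m => ?_) (A.env_hom_ext fun m => ?_)
  · have h := act_homotopyInverse L A m
    rw [key, reassoc_of% E.summandι_orbitMap, reassoc_of% summandSmul_algebraUnit L A m]
    exact h.symm.trans (Category.assoc _ _ _).symm
  · rw [key, contract_one, L.map_id]
    exact (congrArg (· ≫ A.summandι m) (id_whiskerRight _ _)).trans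
      ((Category.id_comp _).trans (Category.comp_id _).symm)

/-- Forgetting the last interval of `halves` leaves `[0, 1/2]`, so the composite is the action of
this unary operation; `growPath` joins it to the operad unit, which acts as the identity. -/
theorem homotopic_comp_orbitMap (E : A.EnvStructure) :
    Homotopic L (homotopyInverse L A ≫ E.orbitMap (algebraUnit L A)) (𝟙 A.X) := by
  have h : homotopyInverse L A ≫ E.orbitMap (algebraUnit L A) =
      (λ_ A.X).inv ≫ ((mapPoint L (halves P) ≫ L.map (dropLast P 1)) ⊗ₘ toPowOne A.X) ≫
        A.act 1 := by
    have h := summandSmul_algebraUnit L A 1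
    rw [← E.summandι_orbitMap] at h
    have key : ∀ {X Y S T : M} (c : 𝟙_ M ⟶ X) (d : X ⟶ Y) (b : A.X ⟶ S) (a : Y ⊗ S ⟶ T)
        (i : X ⊗ S ⟶ A.env) (o : A.env ⟶ T), i ≫ o = d ▷ S ≫ a →
        ((λ_ A.X).inv ≫ (c ⊗ₘ b) ≫ i) ≫ o = (λ_ A.X).inv ≫ ((c ≫ d) ⊗ₘ b) ≫ a := by
      intro X Y S T c d b a i o h
      rw [Category.assoc, Category.assoc, h, tensorHom_comp_whiskerRight_assoc]
    exact key _ _ _ _ _ _ h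
  have key (t : Set.Icc (0 : ℝ) 1) : (λ_ A.X).inv ≫ mapPoint L (ofCoord P t) ▷ A.X ≫
      (L.map (growPath P) ⊗ₘ toPowOne A.X) ≫ A.act 1 = (λ_ A.X).inv ≫
        ((ε L ≫ L.map (constMap (X := 𝟙_ _) (ofCoord P t) ≫ growPath P)) ⊗ₘ toPowOne A.X) ≫
          A.act 1 := by
    have key' : ∀ {X Y S T : M} (c : 𝟙_ M ⟶ X) (d : X ⟶ Y) (b : A.X ⟶ S) (a : Y ⊗ S ⟶ T),
        (λ_ A.X).inv ≫ c ▷ A.X ≫ (d ⊗ₘ b) ≫ a = (λ_ A.X).inv ≫ ((c ≫ d) ⊗ₘ b) ≫ a := by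
      intros
      rw [whiskerRight_comp_tensorHom_assoc]
    refine (key' _ _ _ _).trans ?_
    rw [L.map_comp, mapPoint, Category.assoc]
  refine Homotopic.of_left L ((L.map (growPath P) ⊗ₘ toPowOne A.X) ≫ A.act 1) ?_ ?_
  · rw [key, constMap_growPath_zero, h, mapPoint, Category.assoc, ← L.map_comp]
  · rw [key, constMap_growPath_one]
    have key' : ∀ {Y : M} (o : 𝟙_ M ⟶ Y) (a : Y ⊗ (𝟙_ M ⊗ A.X) ⟶ A.X),
        o ▷ A.X ≫ Y ◁ (λ_ A.X).inv ≫ a = (λ_ A.X).hom →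
        (λ_ A.X).inv ≫ (o ⊗ₘ (λ_ A.X).inv) ≫ a = 𝟙 A.X := by
      intro Y o a h
      rw [MonoidalCategory.tensorHom_def, Category.assoc, h, Iso.inv_hom_id]
    exact key' _ _ A.act_one

end Equivalence

end LittleIntervals

end

theorem mainTheorem7 {P : ObjectProperty TopCat.{w}} [LittleIntervals.ContainsConvexSets P]
    [CartesianMonoidalCategory P.FullSubcategory] [BraidedCategory P.FullSubcategory]
    {M : Type u} [Category.{v} M] [MonoidalCategory M] [SymmetricCategory M] [MonoidalClosed M]
    [HasCountableColimits M]
    (L : P.FullSubcategory ⥤ M) [L.Braided] [L.IsLeftAdjoint]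
    (A : LittleIntervals.OperadAlgebra ((LittleIntervals.littleIntervals P).map L)) :
    Nonempty A.EnvStructure ∧
      ∀ E : A.EnvStructure,
        E.IsModuleMap (E.orbitMap (LittleIntervals.algebraUnit L A)) ∧
          LittleIntervals.IsHomotopyEquivalence L
            (E.orbitMap (LittleIntervals.algebraUnit L A)) := by
  refine ⟨A.nonempty_envStructure (LittleIntervals.lastInputLaws_littleIntervals.map L),
    fun E => ⟨E.isModuleMap_orbitMap _, LittleIntervals.homotopyInverse L A,
      LittleIntervals.homotopic_orbitMap_comp L A E,
      LittleIntervals.homotopic_comp_orbitMap L A E⟩⟩
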